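/- Let $n \ge 1$ be an integer. Consider the unit squares of the planar grid, indexed by $(x,y)\in\mathbb Z^2$; two squares are adjacent if they share an edge, and the square $(x,y)$ has color $x+y \bmod n$. A set of squares is connected if any two of its squares are joined by a path of successively adjacent squares in the set. A ribbon tile of order $n$ is a connected set of squares containing exactly one square of each of the $n$ colors. A region is a finite connected set $R$ of squares, and $R$ is simply connected if no closed walk of successively adjacent squares of $R$ has non-zero winding number around a square $s\notin R$. An order-$n$ ribbon tiling of $R$ is a set of pairwise disjoint ribbon tiles of order $n$ whose union is $R$. Two order-$n$ ribbon tilings of $R$ differ by a local replacement move if one is obtained from the other by removing two distinct tiles and adding another pair of distinct tiles in their place. Theorem. Let $R$ be a simply connected region and let $\alpha,\beta$ be order-$n$ ribbon tilings of $R$. Then there is a finite (possibly empty) sequence of local replacement moves, passing only through order-$n$ ribbon tilings of $R$, that transforms $\alpha$ into $\beta$. -/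

import Mathlib

namespace RibbonTiling

/-- Unit squares of the planar grid, indexed by the integer position `(x, y)`. -/
abbrev Square : Type := ℤ × ℤ

/-- Two squares are adjacent when they share an edge. -/
def grid : SimpleGraph Square where
  Adj p q := |p.1 - q.1| + |p.2 - q.2| = 1
  symm := ⟨fun p q h => by rw [abs_sub_comm q.1, abs_sub_comm q.2]; exact h⟩
  loopless := ⟨fun p h => by simp at h⟩

/-- A set of squares is connected when any two of its squares are joined by a path of
successively adjacent squares inside the set. -/
def IsConnectedSet (S : Finset Square) : Prop :=
  (grid.induce (S : Set Square)).Preconnected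

/-- The color of the square `(x, y)` is `x + y` modulo `n`. -/
def color (n : ℕ) (s : Square) : ZMod n := ((s.1 + s.2 : ℤ) : ZMod n)

/-- The signed crossing of the step from `p` to `q` (adjacent squares) with a ray that issues
from `s`: the horizontal ray to the right of `s`, pushed up to height between `s.2` and
`s.2 + 1`. An upward crossing counts `+1`, a downward one `-1`. -/
def crossing (s p q : Square) : ℤ :=
  if p.1 = q.1 ∧ s.1 < p.1 then
    if p.2 = s.2 ∧ q.2 = s.2 + 1 then 1
    else if p.2 = s.2 + 1 ∧ q.2 = s.2 then -1
    else 0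
  else 0

/-- The winding number about `s` of the closed polygon through the centers of the squares of a
closed walk (meaningful when the walk does not visit `s`): the number of signed crossings with a
ray from `s`. -/
def windingNumber (s : Square) {u : Square} (c : grid.Walk u u) : ℤ :=
  (c.darts.map fun d => crossing s d.fst d.snd).sum

/-- `R` is simply connected when no closed walk through adjacent squares of `R` winds around a
square outside `R`. (Connectedness of `R` is a separate requirement.) -/
def IsSimplyConnectedSet (R : Finset Square) : Prop :=
  ∀ s : Square, s ∉ R → ∀ (u : Square) (c : grid.Walk u u),
    (∀ v ∈ c.support, v ∈ R) → windingNumber s c = 0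

/-- A ribbon tile of order `n`: a connected set of squares that contains exactly one square of
each of the `n` colors. -/
def IsRibbonTile (n : ℕ) (t : Finset Square) : Prop :=
  IsConnectedSet t ∧ ∀ k : ZMod n, ∃! s : Square, s ∈ t ∧ color n s = k

/-- An order-`n` ribbon tiling of `R`: a set of pairwise disjoint ribbon tiles of order `n` whose
union is `R`. -/
def IsRibbonTiling (n : ℕ) (R : Finset Square) (α : Finset (Finset Square)) : Prop :=
  (∀ t ∈ α, IsRibbonTile n t) ∧
  (∀ t ∈ α, ∀ u ∈ α, t ≠ u → Disjoint t u) ∧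
  ∀ s : Square, s ∈ R ↔ ∃ t ∈ α, s ∈ t

/-- A local replacement move between order-`n` ribbon tilings `α`, `β` of `R`: two tiles `t₁`,
`t₂` of `α` are removed and another pair of tiles `u₁`, `u₂` is put in their place. -/
def LocalMove (n : ℕ) (R : Finset Square) (α β : Finset (Finset Square)) : Prop :=
  IsRibbonTiling n R α ∧ IsRibbonTiling n R β ∧
  ∃ t₁ t₂ u₁ u₂ : Finset Square,
    t₁ ∈ α ∧ t₂ ∈ α ∧ t₁ ≠ t₂ ∧ u₁ ≠ u₂ ∧
    ({u₁, u₂} : Finset (Finset Square)) ≠ {t₁, t₂} ∧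
    β = (α \ {t₁, t₂}) ∪ {u₁, u₂}

end RibbonTiling

/-!
Call `x + y` the level of the square `(x, y)`. A ribbon tile is a path that goes up or right at each
step, with one square on each of `n` consecutive diagonals `x + y = k`
(`IsRibbonTile.exists_eq_tileOf`). Two tiles of a tiling that meet equal or neighbouring diagonals
are ordered there by the value of `x - y`, and the order does not depend on the diagonals used
(`IsLabelledTiling.leftOf_iff`). This left-of relation is acyclic
(`IsLabelledTiling.exists_linear_extension`), and it determines the tiling.

The number of tiles of each level depends on the region only (`card_level_eq`). Hence the tiles of
two tilings can be given common labels, which record the level of a tile and its place among the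
tiles of that level (`exists_relabelling`), and the tilings become two acyclic orientations of one
graph on the labels. It remains to turn the first into the second by reversing one edge at a time.

Some edges have the same direction in all tilings. At a vertex of the grid, count the tiles of each
level that pass to its left. Along a lattice edge that does not separate two squares of the region
these counts change by amounts that depend on the region only (`heightDiff_congr`), so the
difference of the counts of two tilings is constant along the boundary. Simple connectedness makes
it vanish at every corner of a square outside the region (`eq_zero_of_notMem`). So a square outside
the region separates the same labels in all tilings (`lt_iff_of_corner`), and tiles whose levels
differ by `n` are never reversed (`not_leftOf_of_level_eq_add`).

If the two orientations differ, then some edge of the first has the opposite direction in the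
second, and no tile of the first lies between its ends (`exists_flip`). The two tiles then touch
along all their common diagonals, and exchanging their parts there is a local move that reverses
this edge alone (`IsLabelledTiling.flip_of_covBy`, `reversedPairs_flip_ssubset`). The theorem
follows by induction on the number of reversed edges.
-/

namespace RibbonTiling

/-! ### Functions on the vertices of a simply connected region -/

theorem crossing_symm (s p q : Square) : crossing s q p = - crossing s p q := by
  unfold crossing
  split_ifs <;> omega

theorem exists_walk_of_isConnectedSet {R : Finset Square} (hconn : IsConnectedSet R)
    {p q : Square} (hp : p ∈ R) (hq : q ∈ R) :
    ∃ w : grid.Walk p q, ∀ v ∈ w.support, v ∈ R := by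
  obtain ⟨w⟩ := hconn ⟨p, hp⟩ ⟨q, hq⟩
  suffices H : ∀ a b : (R : Set Square), (grid.induce (R : Set Square)).Walk a b →
      ∃ w : grid.Walk a.1 b.1, ∀ v ∈ w.support, v ∈ R from H _ _ w
  intro a b w
  induction w with
  | @nil a => exact ⟨.nil, by simp⟩
  | @cons a b c hab _ ih =>
    obtain ⟨w', hw'⟩ := ih
    have hab' : grid.Adj a.1 b.1 := hab
    refine ⟨.cons hab' w', ?_⟩
    rw [SimpleGraph.Walk.support_cons]
    intro v hv
    rcases List.mem_cons.1 hv with rfl | hv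
    · exact a.2
    · exact hw' v hv

/-- Since no closed walk in `R` winds around `s`, the crossing number along walks in `R` is the
increment of a function on squares. -/
theorem exists_crossing_potential {R : Finset Square} (hconn : IsConnectedSet R)
    (hsimply : IsSimplyConnectedSet R) {s : Square} (hs : s ∉ R) :
    ∃ g : Square → ℤ, (∀ p ∉ R, g p = 0) ∧
      ∀ p ∈ R, ∀ q ∈ R, grid.Adj p q → g q - g p = crossing s p q := by
  classical
  rcases R.eq_empty_or_nonempty with rfl | ⟨u, hu⟩
  · exact ⟨0, by simp⟩
  choose w hw using fun p : R => exists_walk_of_isConnectedSet hconn hu p.2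
  refine ⟨fun p => if hp : p ∈ R then
      ((w ⟨p, hp⟩).darts.map fun d => crossing s d.fst d.snd).sum else 0,
    fun p hp => by simp [hp], fun p hp q hq hpq => ?_⟩
  have key := hsimply s hs u
    (((w ⟨p, hp⟩).append (SimpleGraph.Walk.cons hpq .nil)).append (w ⟨q, hq⟩).reverse)
    (by
      intro v hv
      rw [SimpleGraph.Walk.mem_support_append_iff, SimpleGraph.Walk.mem_support_append_iff] at hv
      rcases hv with (hv | hv) | hv
      · exact hw ⟨p, hp⟩ v hv
      · simp at hv
        rcases hv with rfl | rfl <;> assumption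
      · rw [SimpleGraph.Walk.support_reverse, List.mem_reverse] at hv
        exact hw ⟨q, hq⟩ v hv)
  have hrev : ((w ⟨q, hq⟩).reverse.darts.map fun d => crossing s d.fst d.snd).sum =
      - ((w ⟨q, hq⟩).darts.map fun d => crossing s d.fst d.snd).sum := by
    rw [SimpleGraph.Walk.darts_reverse, List.map_reverse, List.sum_reverse, List.map_map]
    induction (w ⟨q, hq⟩).darts with
    | nil => simp
    | cons d l ih =>
      rw [List.map_cons, List.map_cons, List.sum_cons, List.sum_cons, ih]
      have : crossing s d.symm.fst d.symm.snd = - crossing s d.fst d.snd := crossing_symm s _ _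
      simp only [Function.comp, this]
      ring
  simp only [windingNumber, SimpleGraph.Walk.darts_append, List.map_append, List.sum_append,
    hrev, SimpleGraph.Walk.darts_cons, SimpleGraph.Walk.darts_nil, List.map_cons, List.map_nil,
    List.sum_cons, List.sum_nil] at key
  simp only [hp, hq, dif_pos]
  omega

theorem sum_range_int_sub (f : ℤ → ℤ) (a : ℤ) (m : ℕ) :
    ∑ i ∈ Finset.range m, (f (a + i) - f (a + i - 1)) = f (a + m - 1) - f (a - 1) := by
  have := Finset.sum_range_sub (fun i : ℕ => f (a + i - 1)) m
  simp only [Nat.cast_add, Nat.cast_one, Nat.cast_zero, add_zero] at this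
  rw [← this]
  refine Finset.sum_congr rfl fun i _ => ?_
  congr 2
  ring

theorem exists_abs_bound (R : Finset Square) :
    ∃ B : ℕ, ∀ x y : ℤ, (x, y) ∈ R → |x| ≤ B ∧ |y| ≤ B := by
  refine ⟨∑ p ∈ R, (p.1.natAbs + p.2.natAbs), fun x y h => ?_⟩
  have := Finset.single_le_sum (f := fun p : Square => p.1.natAbs + p.2.natAbs)
    (fun _ _ => Nat.zero_le _) h
  simp only [Int.abs_eq_natAbs] at this ⊢
  omega

/-- The form of simple connectedness used for height functions. The vertex `(x, y)` is the lower
left corner of the square `(x, y)`. If `D` has finite support and takes equal values at the ends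
of each lattice edge that does not separate two squares of `R`, then `D` vanishes at the corners
of all squares outside `R`.

Otherwise let `K` be the finite set of squares outside `R` at whose corners `D` has a given
non-zero value. Every square that shares a vertex with `K` lies in `K` or in `R`, and `R` winds
around `K`; with a potential `g` for the crossing number around a square of `K`, the increments of
`g` between squares outside `K`, summed around all vertices, cancel in pairs, but they also add up
to the winding number `1`. -/
theorem eq_zero_of_notMem {R : Finset Square} (hconn : IsConnectedSet R)
    (hsimply : IsSimplyConnectedSet R) (D : ℤ → ℤ → ℤ) (M : ℕ)
    (hM : ∀ x y, D x y ≠ 0 → |x| ≤ M ∧ |y| ≤ M)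
    (hU : ∀ x y, ¬ ((x - 1, y) ∈ R ∧ (x, y) ∈ R) → D x (y + 1) = D x y)
    (hR : ∀ x y, ¬ ((x, y - 1) ∈ R ∧ (x, y) ∈ R) → D (x + 1) y = D x y)
    {x y : ℤ} (hxy : (x, y) ∉ R) : D x y = 0 := by
  classical
  by_contra hd
  obtain ⟨sx, hsx⟩ : ∃ sx, sx = x := ⟨x, rfl⟩
  obtain ⟨sy, hsy⟩ : ∃ sy, sy = y := ⟨y, rfl⟩
  rw [← hsx, ← hsy] at hd hxy
  clear hsx hsy x y
  obtain ⟨g, hg0, hg⟩ := exists_crossing_potential hconn hsimply hxy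
  obtain ⟨B, hB⟩ := exists_abs_bound R
  -- `c` is the indicator of the complement of `K`
  let c : ℤ → ℤ → ℤ := fun x y => if (x, y) ∉ R ∧ D x y = D sx sy then 0 else 1
  let h : ℤ → ℤ → ℤ := fun x y => c (x - 1) y * c x y * (g (x, y) - g (x - 1, y))
  let w : ℤ → ℤ → ℤ := fun x y => c x (y - 1) * c x y * (g (x, y) - g (x, y - 1))
  let b : ℤ → ℤ := fun x => if x ≤ sx then 1 else 1 - c x sy * c x (sy + 1)
  have hgh : ∀ x y, (x - 1, y) ∈ R → (x, y) ∈ R → g (x, y) - g (x - 1, y) = 0 := by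
    intro x y h1 h2
    rw [hg _ h1 _ h2 (by simp [grid])]
    simp [crossing]
  have hgv : ∀ x y, (x, y - 1) ∈ R → (x, y) ∈ R → g (x, y) - g (x, y - 1) =
      if sx < x ∧ y = sy + 1 then 1 else 0 := by
    intro x y h1 h2
    rw [hg _ h1 _ h2 (by simp [grid])]
    unfold crossing
    grind
  have local_sum : ∀ x y, h x (y - 1) + w x y - h x y - w (x - 1) y =
      if y = sy + 1 then b (x - 1) - b x else 0 := by
    intro x y
    have eA : (x - 1, y - 1) ∉ R → D (x - 1) (y - 1) = D x y := fun hA => by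
      have h1 := hR (x - 1) (y - 1) (fun hh => hA hh.2)
      have h2 := hU x (y - 1) (fun hh => hA hh.1)
      rw [sub_add_cancel] at h1 h2
      rw [← h1, ← h2]
    have eB : (x, y - 1) ∉ R → D x (y - 1) = D x y := fun hA => by
      have h2 := hU x (y - 1) (fun hh => hA hh.2)
      rw [sub_add_cancel] at h2
      rw [← h2]
    have eE : (x - 1, y) ∉ R → D (x - 1) y = D x y := fun hA => by
      have h1 := hR (x - 1) y (fun hh => hA hh.2)
      rw [sub_add_cancel] at h1
      rw [← h1]
    by_cases ht : D x y = D sx sy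
    · have cA : c (x - 1) (y - 1) = if (x - 1, y - 1) ∈ R then 1 else 0 := by
        simp only [c]; split_ifs <;> grind
      have cB : c x (y - 1) = if (x, y - 1) ∈ R then 1 else 0 := by
        simp only [c]; split_ifs <;> grind
      have cC : c x y = if (x, y) ∈ R then 1 else 0 := by
        simp only [c]; split_ifs <;> grind
      have cE : c (x - 1) y = if (x - 1, y) ∈ R then 1 else 0 := by
        simp only [c]; split_ifs <;> grind
      have h1 : h x (y - 1) = 0 := by
        simp only [h, cA, cB]
        split_ifs with i1 i2
        · rw [hgh _ _ i1 i2]; simp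
        all_goals simp
      have h2 : h x y = 0 := by
        simp only [h, cE, cC]
        split_ifs with i1 i2
        · rw [hgh _ _ i1 i2]; simp
        all_goals simp
      have h3 : w x y = if sx < x ∧ y = sy + 1 then c x (y - 1) * c x y else 0 := by
        by_cases i : (x, y - 1) ∈ R ∧ (x, y) ∈ R
        · simp only [w]
          rw [hgv _ _ i.1 i.2]
          split_ifs <;> simp
        · have : c x (y - 1) * c x y = 0 := by rw [cB, cC]; grind
          simp [w, this]
      have h4 : w (x - 1) y =
          if sx < x - 1 ∧ y = sy + 1 then c (x - 1) (y - 1) * c (x - 1) y else 0 := by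
        by_cases i : (x - 1, y - 1) ∈ R ∧ (x - 1, y) ∈ R
        · simp only [w]
          rw [hgv _ _ i.1 i.2]
          split_ifs <;> simp
        · have : c (x - 1) (y - 1) * c (x - 1) y = 0 := by rw [cA, cE]; grind
          simp [w, this]
      rw [h1, h2, h3, h4]
      by_cases hy : y = sy + 1
      · obtain rfl : sy = y - 1 := by omega
        simp only [b, sub_add_cancel]
        rcases lt_trichotomy x (sx + 1) with hx | rfl | hx
        · simp [show ¬ sx < x by omega, show ¬ sx < x - 1 by omega, show x - 1 ≤ sx by omega,
            show x ≤ sx by omega]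
        · simp
        · simp [show sx < x by omega, show sx < x - 1 by omega, show ¬ x - 1 ≤ sx by omega,
            show ¬ x ≤ sx by omega]
      · simp [hy]
    · have cA : c (x - 1) (y - 1) = 1 := by
        simp only [c]; split_ifs <;> grind
      have cB : c x (y - 1) = 1 := by
        simp only [c]; split_ifs <;> grind
      have cC : c x y = 1 := by
        simp only [c]; split_ifs <;> grind
      have cE : c (x - 1) y = 1 := by
        simp only [c]; split_ifs <;> grind
      have hL : h x (y - 1) + w x y - h x y - w (x - 1) y = 0 := by
        simp only [h, w, cA, cB, cC, cE]
        ring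
      rw [hL]
      split_ifs with hy
      · obtain rfl : sy = y - 1 := by omega
        simp only [b, sub_add_cancel]
        rcases lt_trichotomy x (sx + 1) with hx | rfl | hx
        · simp [show x - 1 ≤ sx by omega, show x ≤ sx by omega]
        · exfalso
          rw [add_sub_cancel_right] at eA
          exact ht (eA hxy).symm
        · simp [cA, cB, cC, cE, show ¬ x - 1 ≤ sx by omega, show ¬ x ≤ sx by omega]
      · rfl
  obtain ⟨hsx, hsy⟩ := hM _ _ hd
  rw [abs_le] at hsx hsy
  have hgfar : ∀ x y : ℤ, (B < |x| ∨ B < |y|) → g (x, y) = 0 := by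
    intro x y hx
    refine hg0 _ fun hm => ?_
    have := hB x y hm
    omega
  have hcfar : ∀ x y : ℤ, (M : ℤ) < |x| → c x y = 1 := by
    intro x y hx
    simp only [c]
    rw [if_neg]
    rintro ⟨-, hh⟩
    rw [← hh] at hd
    have := (hM x y hd).1
    omega
  -- the sums run over the box `[-L, L] × [-L, L]`
  obtain ⟨L, hL1, hL2⟩ : ∃ L : ℕ, M + 2 ≤ L ∧ B + 2 ≤ L := ⟨M + B + 2, by omega, by omega⟩
  let H : ℤ → ℤ := fun y => ∑ i ∈ Finset.range (2 * L + 1), h (-L + i) y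
  have hrow : ∀ y, H y - H (y - 1) = if y = sy + 1 then -1 else 0 := by
    intro y
    have h1 := Finset.sum_congr (s₁ := Finset.range (2 * L + 1)) rfl
      (fun i _ => local_sum (-L + (i : ℤ)) y)
    have h2 := sum_range_int_sub (fun x => w x y) (-L) (2 * L + 1)
    have h3 := sum_range_int_sub b (-L) (2 * L + 1)
    have hw1 : w (-L + ((2 * L + 1 : ℕ) : ℤ) - 1) y = 0 := by
      simp only [w]
      rw [hgfar _ _ (Or.inl (by rw [lt_abs]; push_cast; omega)),
        hgfar _ _ (Or.inl (by rw [lt_abs]; push_cast; omega))]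
      simp
    have hw2 : w (-L - 1) y = 0 := by
      simp only [w]
      rw [hgfar _ _ (Or.inl (by rw [lt_abs]; omega)), hgfar _ _ (Or.inl (by rw [lt_abs]; omega))]
      simp
    have hb1 : b (-L + ((2 * L + 1 : ℕ) : ℤ) - 1) = 0 := by
      simp only [b]
      rw [if_neg (by push_cast; omega), hcfar _ _ (by rw [lt_abs]; push_cast; omega),
        hcfar _ _ (by rw [lt_abs]; push_cast; omega)]
      simp
    have hb2 : b (-L - 1) = 1 := by
      simp only [b]
      rw [if_pos (by omega)]
    rw [hw1, hw2] at h2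
    rw [hb1, hb2] at h3
    have h4 : ∑ i ∈ Finset.range (2 * L + 1), (h (-L + (i : ℤ)) (y - 1) + w (-L + (i : ℤ)) y
        - h (-L + (i : ℤ)) y - w (-L + (i : ℤ) - 1) y) = H (y - 1) - H y + 0 := by
      rw [← sub_zero (0 : ℤ), ← h2]
      simp only [H, ← Finset.sum_sub_distrib, ← Finset.sum_add_distrib]
      exact Finset.sum_congr rfl fun i _ => by ring
    rw [h4] at h1
    split_ifs at h1 ⊢ with hy
    · have h5 : ∑ i ∈ Finset.range (2 * L + 1), (b (-L + (i : ℤ) - 1) - b (-L + (i : ℤ))) = 1 := by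
        rw [← neg_inj, ← Finset.sum_neg_distrib]
        simp only [neg_sub]
        rw [h3]
        rfl
      omega
    · simp at h1
      omega
  have hfar : ∀ y : ℤ, (B : ℤ) < |y| → H y = 0 := by
    intro y hy
    refine Finset.sum_eq_zero fun i _ => ?_
    simp only [h]
    rw [hgfar _ _ (Or.inr hy), hgfar _ _ (Or.inr hy)]
    simp
  have h1 := sum_range_int_sub H (-L) (2 * L + 1)
  rw [hfar _ (by rw [lt_abs]; push_cast; omega), hfar _ (by rw [lt_abs]; omega)] at h1
  simp only [hrow] at h1
  rw [Finset.sum_eq_single (sy + 1 + L).toNat] at h1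
  · rw [if_pos (by omega)] at h1
    omega
  · intro i _ hi
    rw [if_neg (by omega)]
  · intro hi
    simp at hi
    omega

/-! ### Labelled tilings and the left-of relation -/

/-- A labelled ribbon tiling of `R`. The tile with label `i` has its lowest square on the diagonal
`x + y = lev i`, and for `lev i ≤ k < lev i + n` its square on the diagonal `x + y = k` has first
coordinate `P i k`. Values of `P i` outside that range carry no meaning. -/
structure IsLabelledTiling (n : ℕ) (R : Finset Square) {ι : Type*} (lev : ι → ℤ)
    (P : ι → ℤ → ℤ) : Prop where
  step : ∀ i k, lev i ≤ k → k + 1 < lev i + n → P i (k + 1) = P i k ∨ P i (k + 1) = P i k + 1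
  inj : ∀ i j k, lev i ≤ k → k < lev i + n → lev j ≤ k → k < lev j + n → P i k = P j k → i = j
  mem : ∀ x k : ℤ, (x, k - x) ∈ R ↔ ∃ i, lev i ≤ k ∧ k < lev i + n ∧ P i k = x

/-- The tile `i` lies to the left of the tile `j`: on some pair of equal or neighbouring diagonals
`k`, `k'` the value of `x - y`, which is `2 * x - k` on the diagonal `k`, is smaller for `i`. -/
def LeftOf (n : ℕ) {ι : Type*} (lev : ι → ℤ) (P : ι → ℤ → ℤ) (i j : ι) : Prop :=
  i ≠ j ∧ ∃ k k' : ℤ, (lev i ≤ k ∧ k < lev i + n) ∧ (lev j ≤ k' ∧ k' < lev j + n) ∧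
    (k ≤ k' + 1 ∧ k' ≤ k + 1) ∧ 2 * P i k - k < 2 * P j k' - k'

variable {n : ℕ} {R : Finset Square} {ι κ : Type*} {lev : ι → ℤ} {P Q : ι → ℤ → ℤ}

theorem exists_near_diagonals (i j : ι) (hn : 0 < n) (h1 : lev i ≤ lev j + n)
    (h2 : lev j ≤ lev i + n) :
    ∃ k k' : ℤ, (lev i ≤ k ∧ k < lev i + n) ∧ (lev j ≤ k' ∧ k' < lev j + n) ∧
      (k ≤ k' + 1 ∧ k' ≤ k + 1) := by
  rcases le_total (lev i) (lev j) with hle | hle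
  · refine ⟨min (lev j) (lev i + n - 1), lev j, ?_⟩; omega
  · refine ⟨lev i, min (lev i) (lev j + n - 1), ?_⟩; omega

namespace IsLabelledTiling

theorem lt_iff_succ (h : IsLabelledTiling n R lev P) {i j : ι} (hij : i ≠ j) {k : ℤ}
    (hi : lev i ≤ k) (hi' : k + 1 < lev i + n) (hj : lev j ≤ k) (hj' : k + 1 < lev j + n) :
    P i k < P j k ↔ P i (k + 1) < P j (k + 1) := by
  have h1 := h.step i k hi hi'
  have h2 := h.step j k hj hj'
  have h3 : P i k ≠ P j k := fun e => hij (h.inj i j k hi (by omega) hj (by omega) e)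
  have h4 : P i (k + 1) ≠ P j (k + 1) := fun e =>
    hij (h.inj i j (k + 1) (by omega) (by omega) (by omega) (by omega) e)
  omega

theorem lt_iff_of_le (h : IsLabelledTiling n R lev P) {i j : ι} (hij : i ≠ j) {k m : ℤ}
    (hkm : k ≤ m) (hi : lev i ≤ k) (hi' : m < lev i + n) (hj : lev j ≤ k) (hj' : m < lev j + n) :
    P i k < P j k ↔ P i m < P j m := by
  induction m, hkm using Int.leInduction with
  | base => rfl
  | succ m hm ih =>
    rw [ih (by omega) (by omega)]
    exact h.lt_iff_succ hij (by omega) hi' (by omega) hj'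

/-- On overlapping tiles every comparison on neighbouring diagonals agrees with the comparison on
the lowest common diagonal. -/
theorem key_lt_iff (h : IsLabelledTiling n R lev P) {i j : ι} (hij : i ≠ j)
    (h1 : lev i < lev j + n) (h2 : lev j < lev i + n) {k k' : ℤ}
    (hk : lev i ≤ k ∧ k < lev i + n) (hk' : lev j ≤ k' ∧ k' < lev j + n)
    (hn : k ≤ k' + 1 ∧ k' ≤ k + 1) :
    2 * P i k - k < 2 * P j k' - k' ↔
      P i (max (lev i) (lev j)) < P j (max (lev i) (lev j)) := by
  obtain ⟨hk1, hk2⟩ := hk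
  obtain ⟨hk1', hk2'⟩ := hk'
  have key : ∀ m, lev i ≤ m → m < lev i + n → lev j ≤ m → m < lev j + n →
      (P i (max (lev i) (lev j)) < P j (max (lev i) (lev j)) ↔ P i m < P j m) := fun m a b c d =>
    h.lt_iff_of_le hij (max_le a c) (le_max_left _ _) b (le_max_right _ _) d
  have hne : ∀ m, lev i ≤ m → m < lev i + n → lev j ≤ m → m < lev j + n → P i m ≠ P j m :=
    fun m a b c d e => hij (h.inj i j m a b c d e)
  rcases lt_trichotomy k k' with hlt | rfl | hlt
  · obtain rfl : k' = k + 1 := by omega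
    by_cases hc : lev j ≤ k
    · rw [key k hk1 hk2 hc (by omega)]
      have := h.step j k hc hk2'
      have := hne k hk1 hk2 hc (by omega)
      omega
    · rw [key (k + 1) (by omega) (by omega) (by omega) (by omega)]
      have := h.step i k hk1 (by omega)
      have := hne (k + 1) (by omega) (by omega) (by omega) (by omega)
      omega
  · rw [key k hk1 hk2 hk1' hk2']
    omega
  · obtain rfl : k = k' + 1 := by omega
    by_cases hc : lev i ≤ k'
    · rw [key k' hc (by omega) hk1' (by omega)]
      have := h.step i k' hc (by omega)
      have := hne k' hc (by omega) (by omega) (by omega)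
      omega
    · rw [key (k' + 1) (by omega) (by omega) (by omega) (by omega)]
      have := h.step j k' hk1' (by omega)
      have := hne (k' + 1) (by omega) (by omega) (by omega) (by omega)
      omega

/-- Left and right do not depend on the diagonals on which two tiles are compared. -/
theorem leftOf_iff (h : IsLabelledTiling n R lev P) {i j : ι} (hij : i ≠ j) {k k' : ℤ}
    (hk : lev i ≤ k ∧ k < lev i + n) (hk' : lev j ≤ k' ∧ k' < lev j + n)
    (hn : k ≤ k' + 1 ∧ k' ≤ k + 1) :
    LeftOf n lev P i j ↔ 2 * P i k - k < 2 * P j k' - k' := by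
  refine ⟨?_, fun hlt => ⟨hij, k, k', hk, hk', hn, hlt⟩⟩
  rintro ⟨-, m, m', hm, hm', hmn, hlt⟩
  by_cases ho : lev i < lev j + n ∧ lev j < lev i + n
  · rw [h.key_lt_iff hij ho.1 ho.2 hm hm' hmn] at hlt
    rwa [h.key_lt_iff hij ho.1 ho.2 hk hk' hn]
  · obtain rfl : m = k := by omega
    obtain rfl : m' = k' := by omega
    exact hlt

theorem leftOf_iff_lt (h : IsLabelledTiling n R lev P) {i j : ι} (hij : i ≠ j) {k : ℤ}
    (hk : lev i ≤ k ∧ k < lev i + n) (hk' : lev j ≤ k ∧ k < lev j + n) :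
    LeftOf n lev P i j ↔ P i k < P j k := by
  rw [h.leftOf_iff hij hk hk' (by omega)]
  omega

theorem not_leftOf_iff (h : IsLabelledTiling n R lev P) {i j : ι} (hij : i ≠ j) (hn : 0 < n)
    (h1 : lev i ≤ lev j + n) (h2 : lev j ≤ lev i + n) :
    ¬ LeftOf n lev P i j ↔ LeftOf n lev P j i := by
  obtain ⟨k, k', hk, hk', hkk⟩ := exists_near_diagonals i j hn h1 h2
  rw [h.leftOf_iff hij hk hk' hkk, h.leftOf_iff hij.symm hk' hk hkk.symm]
  have : k = k' → P i k ≠ P j k' := by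
    rintro rfl e
    exact hij (h.inj i j k hk.1 hk.2 hk'.1 hk'.2 e)
  rcases eq_or_ne k k' with e | e
  · have := this e
    omega
  · omega

end IsLabelledTiling

theorem LeftOf.le {i j : ι} (h : LeftOf n lev P i j) :
    lev i ≤ lev j + n ∧ lev j ≤ lev i + n := by
  obtain ⟨-, k, k', hk, hk', hkk, -⟩ := h
  omega

theorem LeftOf.pos {i j : ι} (h : LeftOf n lev P i j) : 0 < n := by
  obtain ⟨-, k, k', hk, hk', hkk, -⟩ := h
  omega

namespace IsLabelledTiling

theorem leftOf_asymm (h : IsLabelledTiling n R lev P) {i j : ι} (hij : LeftOf n lev P i j) :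
    ¬ LeftOf n lev P j i := by
  have := hij.le
  rwa [h.not_leftOf_iff hij.1.symm hij.pos this.2 this.1]

/-- Three tiles whose levels are pairwise at most `n` apart meet a common pair of consecutive
diagonals, on which `x - y` is a linear order. -/
theorem leftOf_trans (h : IsLabelledTiling n R lev P) {i j m : ι} (hij : LeftOf n lev P i j)
    (hjm : LeftOf n lev P j m) (h1 : lev i ≤ lev m + n) (h2 : lev m ≤ lev i + n) :
    LeftOf n lev P i m := by
  have hn := hij.pos
  have a1 := hij.le
  have a2 := hjm.le
  have him : i ≠ m := by
    rintro rfl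
    exact h.leftOf_asymm hij hjm
  obtain ⟨M, hM1, hM2, hM3, hM⟩ : ∃ M, lev i ≤ M ∧ lev j ≤ M ∧ lev m ≤ M ∧
      (M = lev i ∨ M = lev j ∨ M = lev m) :=
    ⟨max (lev i) (max (lev j) (lev m)), by omega⟩
  have ki : lev i ≤ min M (lev i + n - 1) ∧ min M (lev i + n - 1) < lev i + n := by omega
  have kj : lev j ≤ min M (lev j + n - 1) ∧ min M (lev j + n - 1) < lev j + n := by omega
  have km : lev m ≤ min M (lev m + n - 1) ∧ min M (lev m + n - 1) < lev m + n := by omega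
  rw [h.leftOf_iff hij.1 ki kj (by omega)] at hij
  rw [h.leftOf_iff hjm.1 kj km (by omega)] at hjm
  rw [h.leftOf_iff him ki km (by omega)]
  exact hij.trans hjm

/-- The left-of relation is acyclic. The neighbours of a tile of lowest level have pairwise
comparable levels, so such a tile can be inserted last into a linear extension. -/
theorem exists_linear_extension (h : IsLabelledTiling n R lev P) (s : Finset ι) :
    ∃ ρ : ι → ℚ, ∀ i ∈ s, ∀ j ∈ s, LeftOf n lev P i j → ρ i < ρ j := by
  classical
  induction s using Finset.induction_on_min_value lev with
  | empty => exact ⟨0, by simp⟩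
  | insert a s ha hmin ih =>
    obtain ⟨ρ, hρ⟩ := ih
    obtain ⟨r, hr1, hr2⟩ := Order.exists_between_finsets
      ((s.filter fun i => LeftOf n lev P i a).image ρ)
      ((s.filter fun i => LeftOf n lev P a i).image ρ) (by
        simp only [Finset.mem_image, Finset.mem_filter]
        rintro _ ⟨i, ⟨hi, hia⟩, rfl⟩ _ ⟨j, ⟨hj, haj⟩, rfl⟩
        have := hmin i hi
        have := hmin j hj
        have := hia.le
        have := haj.le
        exact hρ i hi j hj (h.leftOf_trans hia haj (by omega) (by omega)))
    simp only [Finset.mem_image, Finset.mem_filter] at hr1 hr2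
    refine ⟨fun i => if i = a then r else ρ i, fun i hi j hj hij => ?_⟩
    rw [Finset.mem_insert] at hi hj
    by_cases hia : i = a
    · subst hia
      have hja : j ≠ i := hij.1.symm
      simpa [hja] using hr2 _ ⟨j, ⟨hj.resolve_left hja, hij⟩, rfl⟩
    · by_cases hja : j = a
      · subst hja
        simpa [hia] using hr1 _ ⟨i, ⟨hi.resolve_left hia, hij⟩, rfl⟩
      · simpa [hia, hja] using hρ i (hi.resolve_left hia) j (hj.resolve_left hja) hij

end IsLabelledTiling

/-! ### Height functions -/

/-- The number of squares of `R` on the diagonal `x + y = k` whose first coordinate is less than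
`x`. -/
def squareCount (R : Finset Square) (k x : ℤ) : ℕ :=
  (R.filter fun s => s.1 + s.2 = k ∧ s.1 < x).card

/-- The number of tiles of level `l` whose square on the diagonal `k` has first coordinate less
than `x`. -/
def tileCount [Fintype ι] (lev : ι → ℤ) (P : ι → ℤ → ℤ) (l k x : ℤ) : ℕ :=
  (Finset.univ.filter fun i => lev i = l ∧ P i k < x).card

theorem squareCount_succ (R : Finset Square) (k x : ℤ) :
    squareCount R k (x + 1) = squareCount R k x + if (x, k - x) ∈ R then 1 else 0 := by
  unfold squareCount
  split_ifs with h
  · rw [← Finset.card_insert_of_notMem (a := ((x, k - x) : Square)) (by simp)]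
    congr 1
    ext ⟨u, v⟩
    simp only [Finset.mem_filter, Finset.mem_insert, Prod.mk.injEq]
    constructor
    · rintro ⟨h1, h2, h3⟩
      by_cases hu : u = x
      · left; omega
      · right; exact ⟨h1, h2, by omega⟩
    · rintro (⟨rfl, rfl⟩ | ⟨h1, h2, h3⟩)
      · exact ⟨h, by omega, by omega⟩
      · exact ⟨h1, h2, by omega⟩
  · rw [add_zero]
    congr 1
    ext ⟨u, v⟩
    simp only [Finset.mem_filter]
    refine ⟨fun ⟨h1, h2, h3⟩ => ⟨h1, h2, ?_⟩, fun ⟨h1, h2, h3⟩ => ⟨h1, h2, by omega⟩⟩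
    rcases (show u < x ∨ u = x by omega) with h4 | rfl
    · exact h4
    · obtain rfl : v = k - u := by omega
      exact absurd h1 h

theorem squareCount_le_add (R : Finset Square) (k : ℤ) {x y : ℤ} (hxy : x ≤ y) :
    (squareCount R k y : ℤ) ≤ squareCount R k x + (y - x) := by
  induction y, hxy using Int.leInduction with
  | base => simp
  | succ y _ ih =>
    rw [squareCount_succ]
    split_ifs <;> push_cast <;> omega

theorem exists_notMem_of_squareCount_lt {k x y : ℤ} (hxy : x ≤ y)
    (h : (squareCount R k y : ℤ) < squareCount R k x + (y - x)) :
    ∃ u, x ≤ u ∧ u < y ∧ (u, k - u) ∉ R := by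
  induction y, hxy using Int.leInduction with
  | base => simp at h
  | succ y _ ih =>
    by_cases hy : (y, k - y) ∈ R
    · rw [squareCount_succ, if_pos hy] at h
      obtain ⟨u, h1, h2, h3⟩ := ih (by push_cast at h; omega)
      exact ⟨u, h1, by omega, h3⟩
    · exact ⟨y, by omega, by omega, hy⟩

theorem tileCount_mono [Fintype ι] (l k : ℤ) {x y : ℤ} (hxy : x ≤ y) :
    tileCount lev P l k x ≤ tileCount lev P l k y := by
  refine Finset.card_le_card fun i => ?_
  simp only [Finset.mem_filter]
  rintro ⟨h1, h2, h3⟩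
  exact ⟨h1, h2, by omega⟩

namespace IsLabelledTiling

/-- Each square of `R` on the diagonal `k` belongs to exactly one of the tiles that meet it. -/
theorem card_active [Fintype ι] (h : IsLabelledTiling n R lev P) (k x : ℤ) :
    (Finset.univ.filter fun i => (lev i ≤ k ∧ k < lev i + n) ∧ P i k < x).card =
      squareCount R k x := by
  refine Finset.card_bij (fun i _ => ((P i k, k - P i k) : Square)) ?_ ?_ ?_
  · intro i hi
    simp only [Finset.mem_filter, Finset.mem_univ, true_and] at hi ⊢
    exact ⟨(h.mem _ _).2 ⟨i, hi.1.1, hi.1.2, rfl⟩, by omega, hi.2⟩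
  · intro i hi j hj hij
    simp only [Finset.mem_filter, Finset.mem_univ, true_and] at hi hj
    exact h.inj i j k hi.1.1 hi.1.2 hj.1.1 hj.1.2 (Prod.mk.inj hij).1
  · rintro ⟨u, v⟩ hs
    simp only [Finset.mem_filter, Finset.mem_univ, true_and] at hs ⊢
    obtain ⟨h1, h2, h3⟩ := hs
    obtain rfl : v = k - u := by omega
    obtain ⟨i, hi1, hi2, hi3⟩ := (h.mem _ _).1 h1
    exact ⟨i, ⟨⟨hi1, hi2⟩, by omega⟩, by rw [hi3]⟩

/-- If no tile that meets the diagonals `k` and `k + 1` passes between the thresholds `x` and `x'`,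
then the tiles that end on the diagonal `k` and those that start on the diagonal `k + 1` are in a
balance determined by `R`. -/
theorem tileCount_add_squareCount [Fintype ι] (h : IsLabelledTiling n R lev P) (hn : 0 < n)
    {k x x' : ℤ}
    (hx : ∀ i, lev i ≤ k → k + 1 < lev i + n → (P i k < x ↔ P i (k + 1) < x')) :
    tileCount lev P (k + 1) (k + 1) x' + squareCount R k x =
      tileCount lev P (k + 1 - n) k x + squareCount R (k + 1) x' := by
  classical
  have h1 : squareCount R (k + 1) x' = tileCount lev P (k + 1) (k + 1) x' +
      (Finset.univ.filter fun i => (lev i ≤ k ∧ k + 1 < lev i + n) ∧ P i (k + 1) < x').card := by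
    rw [← h.card_active, tileCount, ← Finset.card_union_of_disjoint]
    · congr 1
      ext i
      simp only [Finset.mem_filter, Finset.mem_union, Finset.mem_univ, true_and]
      omega
    · refine Finset.disjoint_filter.2 fun i _ => ?_
      omega
  have h2 : squareCount R k x = tileCount lev P (k + 1 - n) k x +
      (Finset.univ.filter fun i => (lev i ≤ k ∧ k + 1 < lev i + n) ∧ P i (k + 1) < x').card := by
    rw [← h.card_active, tileCount, ← Finset.card_union_of_disjoint]
    · congr 1
      ext i
      simp only [Finset.mem_filter, Finset.mem_union, Finset.mem_univ, true_and]
      have := hx i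
      omega
    · refine Finset.disjoint_filter.2 fun i _ => ?_
      omega
  omega

/-- A lattice edge that does not separate two squares of `R` is crossed by no tile. -/
theorem lt_iff_of_up_edge (h : IsLabelledTiling n R lev P) {x y : ℤ}
    (hxy : ¬ ((x - 1, y) ∈ R ∧ (x, y) ∈ R)) {k : ℤ} (hk : k + 1 = x + y) (i : ι) (h1 : lev i ≤ k)
    (h2 : k + 1 < lev i + n) : P i k < x ↔ P i (k + 1) < x := by
  have := h.step i k h1 h2
  by_contra hc
  have e1 : P i k = x - 1 := by omega
  have e2 : P i (k + 1) = x := by omega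
  refine hxy ⟨?_, ?_⟩
  · convert (h.mem (x - 1) k).2 ⟨i, by omega, by omega, e1⟩ using 2; omega
  · convert (h.mem x (k + 1)).2 ⟨i, by omega, by omega, e2⟩ using 2; omega

theorem lt_iff_of_right_edge (h : IsLabelledTiling n R lev P) {x y : ℤ}
    (hxy : ¬ ((x, y - 1) ∈ R ∧ (x, y) ∈ R)) {k : ℤ} (hk : k + 1 = x + y) (i : ι) (h1 : lev i ≤ k)
    (h2 : k + 1 < lev i + n) : P i k < x ↔ P i (k + 1) < x + 1 := by
  have := h.step i k h1 h2
  by_contra hc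
  have e1 : P i k = x := by omega
  have e2 : P i (k + 1) = x := by omega
  refine hxy ⟨?_, ?_⟩
  · convert (h.mem x k).2 ⟨i, by omega, by omega, e1⟩ using 2; omega
  · convert (h.mem x (k + 1)).2 ⟨i, by omega, by omega, e2⟩ using 2; omega

end IsLabelledTiling

/-- The difference of the height functions of two labelled tilings, in the coordinate `c` modulo
`n`, at the vertex `(x, y)`. With `k = x + y - 1`, this vertex lies between the squares
`(x - 1, y)` and `(x, y - 1)` of the diagonal `k`; the height counts, to the left of the vertex,
the tiles of the only level `k - n < l ≤ k` congruent to `c`. -/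
def heightDiff [Fintype ι] (n : ℕ) (lev : ι → ℤ) (P Q : ι → ℤ → ℤ) (c x y : ℤ) : ℤ :=
  (tileCount lev P (x + y - 1 - (x + y - 1 - c) % n) (x + y - 1) x : ℤ) -
    tileCount lev Q (x + y - 1 - (x + y - 1 - c) % n) (x + y - 1) x

theorem heightDiff_congr [Fintype ι] (hP : IsLabelledTiling n R lev P)
    (hQ : IsLabelledTiling n R lev Q) (hn : 0 < n) (c : ℤ) {x y x' y' k : ℤ} (hk : k + 1 = x + y)
    (hk' : k + 2 = x' + y')
    (hPx : ∀ i, lev i ≤ k → k + 1 < lev i + n → (P i k < x ↔ P i (k + 1) < x'))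
    (hQx : ∀ i, lev i ≤ k → k + 1 < lev i + n → (Q i k < x ↔ Q i (k + 1) < x')) :
    heightDiff n lev P Q c x' y' = heightDiff n lev P Q c x y := by
  have hn' : (0 : ℤ) < n := by exact_mod_cast hn
  unfold heightDiff
  rw [show x' + y' - 1 = k + 1 by omega, show x + y - 1 = k by omega]
  obtain ⟨r, hr⟩ : ∃ r, r = (k - c) % n := ⟨_, rfl⟩
  have hr0 : 0 ≤ r := hr ▸ Int.emod_nonneg _ hn'.ne'
  have hrn : r < n := hr ▸ Int.emod_lt_of_pos _ hn'
  have hk1 : k + 1 - c = (r + 1) + n * ((k - c) / n) := by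
    have := Int.emod_add_mul_ediv (k - c) n
    rw [hr]; omega
  rw [← hr, hk1, Int.add_mul_emod_self_left]
  by_cases hlast : r + 1 = n
  · rw [hlast, Int.emod_self, sub_zero, show k - r = k + 1 - n by omega]
    have h1 := hP.tileCount_add_squareCount hn hPx
    have h2 := hQ.tileCount_add_squareCount hn hQx
    omega
  · rw [Int.emod_eq_of_lt (by omega) (by omega), show k + 1 - (r + 1) = k - r by ring]
    have key : ∀ P' : ι → ℤ → ℤ,
        (∀ i, lev i ≤ k → k + 1 < lev i + n → (P' i k < x ↔ P' i (k + 1) < x')) →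
        tileCount lev P' (k - r) (k + 1) x' = tileCount lev P' (k - r) k x := by
      intro P' hP'
      unfold tileCount
      congr 1
      ext i
      simp only [Finset.mem_filter, Finset.mem_univ, true_and]
      have := hP' i
      omega
    rw [key P hPx, key Q hQx]

theorem heightDiff_bounded [Fintype ι] (hP : IsLabelledTiling n R lev P)
    (hQ : IsLabelledTiling n R lev Q) (hn : 0 < n) (c : ℤ) :
    ∃ M : ℕ, ∀ x y, heightDiff n lev P Q c x y ≠ 0 → |x| ≤ M ∧ |y| ≤ M := by
  obtain ⟨B, hB⟩ := exists_abs_bound R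
  have hn' : (0 : ℤ) < n := by exact_mod_cast hn
  refine ⟨3 * B + 1, fun x y hne => ?_⟩
  unfold heightDiff at hne
  obtain ⟨k, hk⟩ : ∃ k, k = x + y - 1 := ⟨_, rfl⟩
  obtain ⟨l, hl⟩ : ∃ l, l = k - (k - c) % n := ⟨_, rfl⟩
  rw [← hk, ← hl] at hne
  have hl0 : l ≤ k := by have := Int.emod_nonneg (k - c) hn'.ne'; omega
  have hln : k < l + n := by have := Int.emod_lt_of_pos (k - c) hn'; omega
  have hPB : ∀ i, lev i = l → |P i k| ≤ B ∧ |k - P i k| ≤ B := fun i hi =>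
    hB _ _ ((hP.mem _ _).2 ⟨i, by omega, by omega, rfl⟩)
  have hQB : ∀ i, lev i = l → |Q i k| ≤ B ∧ |k - Q i k| ≤ B := fun i hi =>
    hB _ _ ((hQ.mem _ _).2 ⟨i, by omega, by omega, rfl⟩)
  obtain ⟨i, hi, hlt⟩ : ∃ i, lev i = l ∧ ¬ (P i k < x ↔ Q i k < x) := by
    by_contra! hc
    apply hne
    have : tileCount lev P l k x = tileCount lev Q l k x := by
      unfold tileCount
      congr 1
      ext i
      simp only [Finset.mem_filter, Finset.mem_univ, true_and]
      exact and_congr_right fun hi => hc i hi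
    omega
  have h1 := hPB i hi
  have h2 := hQB i hi
  simp only [abs_le] at h1 h2 ⊢
  push_cast
  omega

/-- Two labelled tilings of a simply connected region have the same height at each corner of each
square outside the region. -/
theorem tileCount_eq_of_corner [Fintype ι] (hconn : IsConnectedSet R)
    (hsimply : IsSimplyConnectedSet R) (hP : IsLabelledTiling n R lev P)
    (hQ : IsLabelledTiling n R lev Q) (hn : 0 < n) {x y : ℤ} (hxy : (x, y) ∉ R) {v w k l : ℤ}
    (hv : v = x ∨ v = x + 1) (hw : w = y ∨ w = y + 1) (hk : k + 1 = v + w) (hl : l ≤ k)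
    (hl' : k < l + n) : tileCount lev P l k v = tileCount lev Q l k v := by
  obtain ⟨M, hM⟩ := heightDiff_bounded hP hQ hn l
  have hU : ∀ x y, ¬ ((x - 1, y) ∈ R ∧ (x, y) ∈ R) →
      heightDiff n lev P Q l x (y + 1) = heightDiff n lev P Q l x y := fun x y hxy =>
    heightDiff_congr hP hQ hn l (k := x + y - 1) (by ring) (by ring)
      (hP.lt_iff_of_up_edge hxy (by ring)) (hQ.lt_iff_of_up_edge hxy (by ring))
  have hR : ∀ x y, ¬ ((x, y - 1) ∈ R ∧ (x, y) ∈ R) →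
      heightDiff n lev P Q l (x + 1) y = heightDiff n lev P Q l x y := fun x y hxy =>
    heightDiff_congr hP hQ hn l (k := x + y - 1) (by ring) (by ring)
      (hP.lt_iff_of_right_edge hxy (by ring)) (hQ.lt_iff_of_right_edge hxy (by ring))
  have h0 := eq_zero_of_notMem hconn hsimply _ M hM hU hR hxy
  have h1 := hU x y fun hh => hxy hh.2
  have h2 := hR x y fun hh => hxy hh.2
  have h3 := hU (x + 1) y fun hh => hxy (by simpa using hh.1)
  have h4 : heightDiff n lev P Q l v w = 0 := by
    rcases hv with rfl | rfl <;> rcases hw with rfl | rfl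
    · exact h0
    · exact h1.trans h0
    · exact h2.trans h0
    · exact h3.trans (h2.trans h0)
  unfold heightDiff at h4
  rw [show v + w - 1 = k by omega, Int.emod_eq_of_lt (by omega) (by omega),
    show k - (k - l) = l by ring] at h4
  omega

/-! ### Relative positions determined by the region -/

/-- Two labelled tilings with the same levels list the tiles of each level in the same order from
left to right. -/
def SameOrder (lev : ι → ℤ) (P Q : ι → ℤ → ℤ) : Prop :=
  ∀ i j, lev i = lev j → (P i (lev i) < P j (lev i) ↔ Q i (lev i) < Q j (lev i))

theorem SameOrder.symm (h : SameOrder lev P Q) : SameOrder lev Q P :=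
  fun i j hij => (h i j hij).symm

theorem SameOrder.lt_iff (h : SameOrder lev P Q) (hP : IsLabelledTiling n R lev P)
    (hQ : IsLabelledTiling n R lev Q) {i j : ι} (hij : lev i = lev j) {k : ℤ} (hk : lev i ≤ k)
    (hk' : k < lev i + n) : P i k < P j k ↔ Q i k < Q j k := by
  rcases eq_or_ne i j with rfl | hne
  · simp
  · rw [← hP.lt_iff_of_le hne hk le_rfl hk' hij.ge (hij ▸ hk'),
      ← hQ.lt_iff_of_le hne hk le_rfl hk' hij.ge (hij ▸ hk')]
    exact h i j hij

theorem SameOrder.tileCount_eq [Fintype ι] (h : SameOrder lev P Q)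
    (hP : IsLabelledTiling n R lev P) (hQ : IsLabelledTiling n R lev Q) (i : ι) {k : ℤ}
    (hk : lev i ≤ k) (hk' : k < lev i + n) :
    tileCount lev P (lev i) k (P i k) = tileCount lev Q (lev i) k (Q i k) := by
  unfold tileCount
  congr 1
  ext j
  simp only [Finset.mem_filter, Finset.mem_univ, true_and]
  exact and_congr_right fun hj => h.lt_iff hP hQ hj (hj ▸ hk) (hj ▸ hk')

theorem SameOrder.lt_of_tileCount_eq [Fintype ι] (h : SameOrder lev P Q)
    (hP : IsLabelledTiling n R lev P) (hQ : IsLabelledTiling n R lev Q) {i : ι} {k x : ℤ}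
    (hk : lev i ≤ k) (hk' : k < lev i + n)
    (hc : tileCount lev P (lev i) k x = tileCount lev Q (lev i) k x) (hx : P i k < x) :
    Q i k < x := by
  by_contra hQx
  refine (Finset.card_lt_card (Finset.ssubset_iff_of_subset ?_ |>.2 ⟨i, ?_, ?_⟩)).ne' hc
  · intro j
    simp only [Finset.mem_filter, Finset.mem_univ, true_and]
    rintro ⟨h1, h2⟩
    have := (h.lt_iff hP hQ h1 (h1 ▸ hk) (h1 ▸ hk')).2 (by omega)
    exact ⟨h1, by omega⟩
  · simpa using hx
  · simpa using hQx

/-- Squares outside a simply connected region separate the same labels in all tilings. -/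
theorem lt_iff_of_corner [Fintype ι] (hconn : IsConnectedSet R)
    (hsimply : IsSimplyConnectedSet R) (hP : IsLabelledTiling n R lev P)
    (hQ : IsLabelledTiling n R lev Q) (h : SameOrder lev P Q) {x y : ℤ}
    (hxy : (x, y) ∉ R) {v w k : ℤ} (hv : v = x ∨ v = x + 1) (hw : w = y ∨ w = y + 1)
    (hk : k + 1 = v + w) {i : ι} (hi : lev i ≤ k) (hi' : k < lev i + n) :
    P i k < v ↔ Q i k < v := by
  have hn : 0 < n := by omega
  have := tileCount_eq_of_corner hconn hsimply hP hQ hn hxy hv hw hk hi hi'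
  exact ⟨h.lt_of_tileCount_eq hP hQ hi hi' this, h.symm.lt_of_tileCount_eq hQ hP hi hi' this.symm⟩

/-- The relative position of a tile and of a tile that starts on the diagonal just above it is the
same in all tilings of a simply connected region. A reversal would violate the balance of ending
and starting tiles, unless a square outside the region lay between the two places. -/
theorem not_leftOf_of_level_eq_add [Fintype ι] (hconn : IsConnectedSet R)
    (hsimply : IsSimplyConnectedSet R) (hP : IsLabelledTiling n R lev P)
    (hQ : IsLabelledTiling n R lev Q) (h : SameOrder lev P Q) {i j : ι}
    (hij : lev j = lev i + n) (hl : LeftOf n lev P i j) : ¬ LeftOf n lev Q j i := by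
  intro hl'
  have hn := hl.pos
  have hne := hl.1
  obtain ⟨k, hk⟩ : ∃ k, k = lev i + n - 1 := ⟨_, rfl⟩
  rw [hP.leftOf_iff hne (k := k) (k' := k + 1) (by omega) (by omega) (by omega)] at hl
  rw [hQ.leftOf_iff hne.symm (k := k + 1) (k' := k) (by omega) (by omega) (by omega)] at hl'
  have e1 := h.tileCount_eq hP hQ i (k := k) (by omega) (by omega)
  have e2 := h.tileCount_eq hP hQ j (k := k + 1) (by omega) (by omega)
  have lti : tileCount lev P (lev i) k (P i k) < tileCount lev P (lev i) k (P i k + 1) := by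
    refine Finset.card_lt_card (Finset.ssubset_iff_of_subset ?_ |>.2 ⟨i, ?_, ?_⟩)
    · intro u
      simp only [Finset.mem_filter, Finset.mem_univ, true_and]
      omega
    · simp
    · simp
  have ltj : tileCount lev Q (lev j) (k + 1) (Q j (k + 1)) <
      tileCount lev Q (lev j) (k + 1) (Q j (k + 1) + 1) := by
    refine Finset.card_lt_card (Finset.ssubset_iff_of_subset ?_ |>.2 ⟨j, ?_, ?_⟩)
    · intro u
      simp only [Finset.mem_filter, Finset.mem_univ, true_and]
      omega
    · simp
    · simp
  have m1 := tileCount_mono (lev := lev) (P := P) (lev j) (k + 1)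
    (show P i k + 1 ≤ P j (k + 1) by omega)
  have m2 := tileCount_mono (lev := lev) (P := Q) (lev i) k (show Q j (k + 1) ≤ Q i k by omega)
  -- the edge to the right of the last square of `i` is crossed by no tile of `P`
  have b1 := hP.tileCount_add_squareCount hn (k := k) (x := P i k + 1) (x' := P i k + 1) (by
    intro u hu hu'
    have := hP.step u k hu hu'
    have : P u k ≠ P i k := fun e => by
      have := hP.inj u i k hu (by omega) (by omega) (by omega) e
      subst this
      omega
    omega)
  -- the edge below the first square of `j` is crossed by no tile of `Q`
  have b2 := hQ.tileCount_add_squareCount hn (k := k) (x := Q j (k + 1)) (x' := Q j (k + 1) + 1) (by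
    intro u hu hu'
    have := hQ.step u k hu hu'
    have : Q u (k + 1) ≠ Q j (k + 1) := fun e => by
      have := hQ.inj u j (k + 1) (by omega) (by omega) (by omega) (by omega) e
      subst this
      omega
    omega)
  rw [show k + 1 - (n : ℤ) = lev i by omega] at b1 b2
  rw [show lev j = k + 1 by omega] at e2 ltj m1
  rcases le_or_gt (P i k + 1) (Q j (k + 1)) with hc | hc
  · have s1 := squareCount_le_add R (k + 1) (show P i k + 1 ≤ Q j (k + 1) + 1 by omega)
    obtain ⟨u, hu1, hu2, hu3⟩ := exists_notMem_of_squareCount_lt (R := R) (k := k) hc (by omega)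
    have := lt_iff_of_corner hconn hsimply hP hQ h hu3 (v := u) (w := k - u + 1) (k := k) (i := i)
      (by omega) (by omega) (by omega) (by omega) (by omega)
    omega
  · have s1 := squareCount_le_add R k (show Q j (k + 1) ≤ P i k + 1 by omega)
    obtain ⟨u, hu1, hu2, hu3⟩ := exists_notMem_of_squareCount_lt (R := R) (k := k + 1)
      (show Q j (k + 1) + 1 ≤ P i k + 1 by omega) (by omega)
    have := lt_iff_of_corner hconn hsimply hP hQ h hu3 (v := u) (w := k + 1 - u + 1) (k := k + 1)
      (i := j) (by omega) (by omega) (by omega) (by omega) (by omega)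
    omega

/-! ### Exchange of two tiles -/

/-- The pairs of labels whose tiles lie in opposite order in the labelled tilings `P` and `Q`. -/
def reversedPairs (n : ℕ) (lev : ι → ℤ) (P Q : ι → ℤ → ℤ) : Set (ι × ι) :=
  {x | LeftOf n lev P x.1 x.2 ∧ LeftOf n lev Q x.2 x.1}

open Classical in
/-- Exchange of the tiles `p` and `q`, of levels `lev p < lev q < lev p + n`, on the diagonals
that both of them meet. -/
noncomputable def flip (n : ℕ) (lev : ι → ℤ) (P : ι → ℤ → ℤ) (p q : ι) : ι → ℤ → ℤ := fun i k =>
  if i = p then (if k < lev q then P p k else P q k)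
  else if i = q then (if k < lev p + n then P p k else P q k)
  else P i k

theorem flip_left (p q : ι) (k : ℤ) :
    flip n lev P p q p k = if k < lev q then P p k else P q k := by
  simp [flip]

theorem flip_right {p q : ι} (hpq : p ≠ q) (k : ℤ) :
    flip n lev P p q q k = if k < lev p + n then P p k else P q k := by
  simp [flip, hpq.symm]

theorem flip_of_ne {p q i : ι} (hp : i ≠ p) (hq : i ≠ q) (k : ℤ) :
    flip n lev P p q i k = P i k := by
  simp [flip, hp, hq]

/-- On each diagonal, an exchange either changes nothing or swaps two labels. -/
theorem exists_perm_flip {p q : ι} (h1 : lev p < lev q) (k : ℤ) :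
    ∃ σ : Equiv.Perm ι, ∀ i, lev i ≤ k → k < lev i + n →
      lev (σ i) ≤ k ∧ k < lev (σ i) + n ∧ lev (σ.symm i) ≤ k ∧ k < lev (σ.symm i) + n ∧
        flip n lev P p q i k = P (σ i) k := by
  classical
  have hpq : p ≠ q := by rintro rfl; omega
  by_cases hk : lev q ≤ k ∧ k < lev p + n
  · refine ⟨Equiv.swap p q, fun i hi hi' => ?_⟩
    rw [Equiv.symm_swap]
    rcases eq_or_ne i p with rfl | hp
    · rw [Equiv.swap_apply_left, flip_left, if_neg (by omega)]
      exact ⟨by omega, by omega, by omega, by omega, rfl⟩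
    · rcases eq_or_ne i q with rfl | hq
      · rw [Equiv.swap_apply_right, flip_right hpq, if_pos (by omega)]
        exact ⟨by omega, by omega, by omega, by omega, rfl⟩
      · rw [Equiv.swap_apply_of_ne_of_ne hp hq, flip_of_ne hp hq]
        exact ⟨hi, hi', hi, hi', rfl⟩
  · refine ⟨Equiv.refl ι, fun i hi hi' => ⟨hi, hi', hi, hi', ?_⟩⟩
    rcases eq_or_ne i p with rfl | hp
    · rw [flip_left, if_pos (by omega)]
      rfl
    · rcases eq_or_ne i q with rfl | hq
      · rw [flip_right hpq, if_neg (by omega)]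
        rfl
      · exact flip_of_ne hp hq k

namespace IsLabelledTiling

theorem flip (h : IsLabelledTiling n R lev P) {p q : ι} (h1 : lev p < lev q)
    (h2 : lev q < lev p + n)
    (hbot : P q (lev q) = P p (lev q - 1) ∨ P q (lev q) = P p (lev q - 1) + 1)
    (htop : P q (lev p + n) = P p (lev p + n - 1) ∨ P q (lev p + n) = P p (lev p + n - 1) + 1) :
    IsLabelledTiling n R lev (flip n lev P p q) where
  step := by
    intro i k hi hi'
    have hpq : p ≠ q := by rintro rfl; omega
    rcases eq_or_ne i p with rfl | hp
    · rw [flip_left, flip_left]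
      rcases lt_trichotomy (k + 1) (lev q) with hk | hk | hk
      · rw [if_pos (by omega), if_pos (by omega)]
        exact h.step i k hi hi'
      · rw [if_neg (by omega), if_pos (by omega)]
        rw [← hk, add_sub_cancel_right] at hbot
        exact hbot
      · rw [if_neg (by omega), if_neg (by omega)]
        exact h.step q k (by omega) (by omega)
    · rcases eq_or_ne i q with rfl | hq
      · rw [flip_right hpq, flip_right hpq]
        rcases lt_trichotomy (k + 1) (lev p + n) with hk | hk | hk
        · rw [if_pos (by omega), if_pos (by omega)]
          exact h.step p k (by omega) hk
        · rw [if_neg (by omega), if_pos (by omega)]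
          rw [← hk, add_sub_cancel_right] at htop
          exact htop
        · rw [if_neg (by omega), if_neg (by omega)]
          exact h.step i k (by omega) (by omega)
      · rw [flip_of_ne hp hq, flip_of_ne hp hq]
        exact h.step i k hi hi'
  inj := by
    intro i j k hi hi' hj hj' hij
    obtain ⟨σ, hσ⟩ := exists_perm_flip (n := n) (P := P) h1 k
    obtain ⟨a1, a2, -, -, a3⟩ := hσ i hi hi'
    obtain ⟨b1, b2, -, -, b3⟩ := hσ j hj hj'
    rw [a3, b3] at hij
    exact σ.injective (h.inj _ _ k a1 a2 b1 b2 hij)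
  mem := by
    intro x k
    obtain ⟨σ, hσ⟩ := exists_perm_flip (n := n) (P := P) h1 k
    rw [h.mem]
    constructor
    · rintro ⟨i, hi, hi', hx⟩
      obtain ⟨-, -, a1, a2, -⟩ := hσ i hi hi'
      obtain ⟨-, -, -, -, a3⟩ := hσ _ a1 a2
      exact ⟨σ.symm i, a1, a2, by rw [a3, Equiv.apply_symm_apply, hx]⟩
    · rintro ⟨i, hi, hi', hx⟩
      obtain ⟨a1, a2, -, -, a3⟩ := hσ i hi hi'
      exact ⟨σ i, a1, a2, by rw [← a3, hx]⟩

theorem sameOrder_flip (h : IsLabelledTiling n R lev P) {p q : ι} (h1 : lev p < lev q)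
    (h2 : lev q < lev p + n) (h' : IsLabelledTiling n R lev (RibbonTiling.flip n lev P p q)) :
    SameOrder lev (RibbonTiling.flip n lev P p q) P := by
  have hpq : p ≠ q := by rintro rfl; omega
  intro i j hij
  rcases eq_or_ne i j with rfl | hne
  · simp
  by_cases hq : lev i = lev q
  · -- only `q` can be affected, and it keeps its highest square
    have key : ∀ m, lev m = lev q →
        RibbonTiling.flip n lev P p q m (lev q + n - 1) = P m (lev q + n - 1) := by
      intro m hm
      have hmp : m ≠ p := by rintro rfl; omega
      rcases eq_or_ne m q with rfl | hmq
      · rw [flip_right hpq, if_neg (by omega)]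
      · exact flip_of_ne hmp hmq _
    rw [h.lt_iff_of_le hne (m := lev q + n - 1) (by omega) le_rfl (by omega) (by omega) (by omega),
      h'.lt_iff_of_le hne (m := lev q + n - 1) (by omega) le_rfl (by omega) (by omega) (by omega),
      key i hq, key j (by omega)]
  · have key : ∀ m, lev m = lev i → RibbonTiling.flip n lev P p q m (lev i) = P m (lev i) := by
      intro m hm
      have hmq : m ≠ q := by rintro rfl; omega
      rcases eq_or_ne m p with rfl | hmp
      · rw [flip_left, if_pos (by omega)]
      · exact flip_of_ne hmp hmq _
    rw [key i rfl, key j hij.symm]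

/-- Two tiles that are neighbours in the left-of relation of `P` and lie in opposite order in `Q`
touch along all the diagonals that both of them meet, and can be exchanged there: a square between
them would belong to a tile between them, or lie outside `R` and fix their order. -/
theorem flip_of_covBy [Fintype ι] (hconn : IsConnectedSet R) (hsimply : IsSimplyConnectedSet R)
    (hP : IsLabelledTiling n R lev P) (hQ : IsLabelledTiling n R lev Q) (h : SameOrder lev P Q)
    {a b p q : ι} (hab : LeftOf n lev P a b) (hba : LeftOf n lev Q b a)
    (hcov : ∀ s, LeftOf n lev P a s → ¬ LeftOf n lev P s b)
    (hpq : p = a ∧ q = b ∨ p = b ∧ q = a) (h1 : lev p < lev q) (h2 : lev q < lev p + n) :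
    IsLabelledTiling n R lev (RibbonTiling.flip n lev P p q) := by
  -- no square outside `R` has a corner that separates the two tiles
  have hin : ∀ x y v w k : ℤ, (v = x ∨ v = x + 1) → (w = y ∨ w = y + 1) → k + 1 = v + w →
      lev q ≤ k → k < lev p + n → P a k < v → v ≤ P b k → (x, y) ∈ R := by
    intro x y v w k hv hw hk hk1 hk2 hva hvb
    by_contra hxy
    have ha := lt_iff_of_corner hconn hsimply hP hQ h hxy hv hw hk (i := a) (by grind) (by grind)
    have hb := lt_iff_of_corner hconn hsimply hP hQ h hxy hv hw hk (i := b) (by grind) (by grind)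
    rw [hQ.leftOf_iff_lt hba.1 (k := k) (by grind) (by grind)] at hba
    omega
  -- on the diagonals `k`, `k'`, `k''` no tile lies between the two tiles
  have hbetween : ∀ s k k' k'', (lev a ≤ k ∧ k < lev a + n) → (lev s ≤ k' ∧ k' < lev s + n) →
      (lev b ≤ k'' ∧ k'' < lev b + n) → (k ≤ k' + 1 ∧ k' ≤ k + 1) → (k' ≤ k'' + 1 ∧ k'' ≤ k' + 1) →
      s ≠ a → s ≠ b →
      ¬ (2 * P a k - k < 2 * P s k' - k' ∧ 2 * P s k' - k' < 2 * P b k'' - k'') := by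
    intro s k k' k'' ha hs hb n1 n2 hsa hsb hlt
    exact hcov s ⟨hsa.symm, k, k', ha, hs, n1, hlt.1⟩ ⟨hsb, k', k'', hs, hb, n2, hlt.2⟩
  have hadj : ∀ k, lev q ≤ k → k < lev p + n → P b k = P a k + 1 := by
    intro k hk1 hk2
    have hlt := (hP.leftOf_iff_lt hab.1 (k := k) (by grind) (by grind)).1 hab
    by_contra hgap
    have hm := hin (P a k + 1) (k - (P a k + 1)) (P a k + 1) (k - (P a k + 1) + 1) k (by omega)
      (by omega) (by omega) hk1 hk2 (by omega) (by omega)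
    obtain ⟨s, hs1, hs2, hs⟩ := (hP.mem _ _).1 hm
    exact hbetween s k k k (by grind) ⟨hs1, hs2⟩ (by grind) (by omega) (by omega)
      (by rintro rfl; omega) (by rintro rfl; omega) (by omega)
  refine hP.flip h1 h2 ?_ ?_
  · have e := hadj (lev q) le_rfl h2
    have hm := hin (P a (lev q)) (lev q - 1 - P a (lev q)) (P a (lev q) + 1)
      (lev q - 1 - P a (lev q) + 1) (lev q) (by omega) (by omega) (by omega) le_rfl h2 (by omega)
      (by omega)
    obtain ⟨s, hs1, hs2, hs⟩ := (hP.mem _ _).1 hm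
    have hst := hP.step p (lev q - 1) (by omega) (by omega)
    rw [sub_add_cancel] at hst
    have hsq : s ≠ q := by rintro rfl; omega
    by_cases hsp : s = p
    · subst hsp
      rcases hpq with ⟨rfl, rfl⟩ | ⟨rfl, rfl⟩ <;> omega
    · exfalso
      have hne : P p (lev q - 1) ≠ P s (lev q - 1) := fun e' =>
        hsp (hP.inj s p (lev q - 1) hs1 hs2 (by omega) (by omega) e'.symm)
      rcases hpq with ⟨rfl, rfl⟩ | ⟨rfl, rfl⟩
      · exact hbetween s (lev q - 1) (lev q - 1) (lev q) (by omega) ⟨hs1, hs2⟩ (by omega) (by omega)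
          (by omega) hsp hsq (by omega)
      · exact hbetween s (lev q) (lev q - 1) (lev q - 1) (by omega) ⟨hs1, hs2⟩ (by omega) (by omega)
          (by omega) hsq hsp (by omega)
  · obtain ⟨k, hk⟩ : ∃ k, k = lev p + n - 1 := ⟨_, rfl⟩
    rw [show lev p + n = k + 1 by omega, add_sub_cancel_right]
    have e := hadj k (by omega) (by omega)
    have hm := hin (P a k + 1) (k + 1 - (P a k + 1)) (P a k + 1) (k + 1 - (P a k + 1)) k
      (by omega) (by omega) (by omega) (by omega) (by omega) (by omega) (by omega)
    obtain ⟨s, hs1, hs2, hs⟩ := (hP.mem _ _).1 hm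
    have hst := hP.step q k (by omega) (by omega)
    have hsp : s ≠ p := by rintro rfl; omega
    by_cases hsq : s = q
    · subst hsq
      rcases hpq with ⟨rfl, rfl⟩ | ⟨rfl, rfl⟩ <;> omega
    · exfalso
      have hne : P q (k + 1) ≠ P s (k + 1) := fun e' =>
        hsq (hP.inj s q (k + 1) hs1 hs2 (by omega) (by omega) e'.symm)
      rcases hpq with ⟨rfl, rfl⟩ | ⟨rfl, rfl⟩
      · exact hbetween s k (k + 1) (k + 1) (by omega) ⟨hs1, hs2⟩ (by omega) (by omega)
          (by omega) hsp hsq (by omega)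
      · exact hbetween s (k + 1) (k + 1) k (by omega) ⟨hs1, hs2⟩ (by omega) (by omega)
          (by omega) hsq hsp (by omega)

end IsLabelledTiling

/-- The exchange of two neighbours in the left-of relation reverses the order of these two tiles
and of no others. -/
theorem reversedPairs_flip_ssubset (hP : IsLabelledTiling n R lev P)
    (hQ : IsLabelledTiling n R lev Q) {a b p q : ι} (hab : LeftOf n lev P a b)
    (hba : LeftOf n lev Q b a) (hcov : ∀ s, LeftOf n lev P a s → ¬ LeftOf n lev P s b)
    (hpq : p = a ∧ q = b ∨ p = b ∧ q = a) (h1 : lev p < lev q) (h2 : lev q < lev p + n)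
    (h' : IsLabelledTiling n R lev (flip n lev P p q)) :
    reversedPairs n lev (flip n lev P p q) Q ⊂ reversedPairs n lev P Q := by
  have hne : p ≠ q := by rintro rfl; omega
  have hrev : ¬ LeftOf n lev (flip n lev P p q) a b := by
    rw [h'.leftOf_iff_lt hab.1 (k := lev q) (by grind) (by grind)]
    rw [hP.leftOf_iff_lt hab.1 (k := lev q) (by grind) (by grind)] at hab
    have e1 := flip_left (n := n) (lev := lev) (P := P) p q (lev q)
    have e2 := flip_right (n := n) (lev := lev) (P := P) hne (lev q)
    rw [if_neg (by omega)] at e1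
    rw [if_pos (by omega)] at e2
    rcases hpq with ⟨rfl, rfl⟩ | ⟨rfl, rfl⟩ <;> omega
  -- each square of the new tile `t` belongs to one of the two old tiles
  have hold : ∀ t k, t = p ∨ t = q → lev t ≤ k → k < lev t + n →
      ∃ u, (u = p ∨ u = q) ∧ lev u ≤ k ∧ k < lev u + n ∧ flip n lev P p q t k = P u k := by
    rintro t k (rfl | rfl) hk hk'
    · rw [flip_left]
      split_ifs
      · exact ⟨t, .inl rfl, hk, hk', rfl⟩
      · exact ⟨q, .inr rfl, by omega, by omega, rfl⟩
    · rw [flip_right hne]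
      split_ifs
      · exact ⟨p, .inl rfl, by omega, by omega, rfl⟩
      · exact ⟨t, .inr rfl, by omega, by omega, rfl⟩
  have hpos := hab.pos
  -- order relative to a third tile `s`, from the tile `u` to the tile `t`
  have hl : ∀ s t u, s ≠ t → (t = p ∨ t = q) → (u = p ∨ u = q) →
      lev t ≤ lev s + n → lev s ≤ lev t + n → LeftOf n lev P u s → LeftOf n lev P t s := by
    intro s t u hst ht hu l1 l2 hus
    by_contra hts
    rw [hP.not_leftOf_iff hst.symm hpos l1 l2] at hts
    by_cases hut : u = t
    · subst hut
      exact hP.leftOf_asymm hus hts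
    · rcases (show (u = a ∧ t = b) ∨ (u = b ∧ t = a) by grind) with ⟨rfl, rfl⟩ | ⟨rfl, rfl⟩
      · exact hcov s hus hts
      · have := hP.leftOf_trans hus hts (by grind) (by grind)
        exact hP.leftOf_asymm hab this
  have hr : ∀ s t u, s ≠ t → (t = p ∨ t = q) → (u = p ∨ u = q) →
      lev t ≤ lev s + n → lev s ≤ lev t + n → LeftOf n lev P s u → LeftOf n lev P s t := by
    intro s t u hst ht hu l1 l2 hus
    by_contra hts
    rw [hP.not_leftOf_iff hst hpos l2 l1] at hts
    by_cases hut : u = t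
    · subst hut
      exact hP.leftOf_asymm hus hts
    · rcases (show (u = a ∧ t = b) ∨ (u = b ∧ t = a) by grind) with ⟨rfl, rfl⟩ | ⟨rfl, rfl⟩
      · have := hP.leftOf_trans hts hus (by grind) (by grind)
        exact hP.leftOf_asymm hab this
      · exact hcov s hts hus
  refine (Set.ssubset_iff_of_subset ?_).2 ⟨(a, b), ⟨hab, hba⟩, fun hh => hrev hh.1⟩
  rintro ⟨i, j⟩ ⟨hij, hji⟩
  refine ⟨?_, hji⟩
  simp only at hij hji ⊢
  have hle := hij.le
  obtain ⟨hne', k, k', hk, hk', hkk, hlt⟩ := id hij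
  by_cases hi : i = p ∨ i = q
  · by_cases hj : j = p ∨ j = q
    · rcases (show (i = a ∧ j = b) ∨ (i = b ∧ j = a) by grind) with ⟨rfl, rfl⟩ | ⟨rfl, rfl⟩
      · exact absurd hij hrev
      · exact absurd hba (hQ.leftOf_asymm hji)
    · push Not at hj
      obtain ⟨u, hu, u1, u2, e⟩ := hold i k hi hk.1 hk.2
      rw [e, flip_of_ne hj.1 hj.2] at hlt
      have huj : u ≠ j := by rintro rfl; exact hu.elim hj.1 hj.2
      exact hl j i u hne'.symm hi hu hle.1 hle.2 ⟨huj, k, k', ⟨u1, u2⟩, hk', hkk, hlt⟩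
  · push Not at hi
    rw [flip_of_ne hi.1 hi.2] at hlt
    by_cases hj : j = p ∨ j = q
    · obtain ⟨u, hu, u1, u2, e⟩ := hold j k' hj hk'.1 hk'.2
      rw [e] at hlt
      have hui : i ≠ u := by rintro rfl; exact hu.elim hi.1 hi.2
      exact hr i j u hne' hj hu hle.2 hle.1 ⟨hui, k, k', hk, ⟨u1, u2⟩, hkk, hlt⟩
    · push Not at hj
      rw [flip_of_ne hj.1 hj.2] at hlt
      exact ⟨hne', k, k', hk, hk', hkk, hlt⟩

/-- Some exchange in `P` brings it closer to `Q`. Among the pairs in opposite order take one that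
is closest in a linear extension of the left-of relation of `P`. A tile between the two tiles of
this pair in `P` would lie between them, in the same order, in `Q` too, and close a directed
triangle there. -/
theorem exists_flip [Fintype ι] (hconn : IsConnectedSet R) (hsimply : IsSimplyConnectedSet R)
    (hP : IsLabelledTiling n R lev P) (hQ : IsLabelledTiling n R lev Q) (h : SameOrder lev P Q)
    (hne : (reversedPairs n lev P Q).Nonempty) :
    ∃ p q, lev p < lev q ∧ lev q < lev p + n ∧ P p (lev q) ≠ P q (lev q) ∧
      IsLabelledTiling n R lev (flip n lev P p q) ∧ SameOrder lev (flip n lev P p q) Q ∧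
      reversedPairs n lev (flip n lev P p q) Q ⊂ reversedPairs n lev P Q := by
  classical
  obtain ⟨ρ, hρ⟩ := hP.exists_linear_extension Finset.univ
  replace hρ := fun i j => hρ i (Finset.mem_univ i) j (Finset.mem_univ j)
  obtain ⟨⟨a, b⟩, hm, hmin⟩ := Set.exists_min_image (reversedPairs n lev P Q)
    (fun x => ρ x.2 - ρ x.1) (Set.toFinite _) hne
  obtain ⟨hab, hba⟩ := hm
  simp only at hab hba hmin
  have hpos := hab.pos
  have hcov : ∀ s, LeftOf n lev P a s → ¬ LeftOf n lev P s b := by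
    intro s has hsb
    have r1 := hρ _ _ has
    have r2 := hρ _ _ hsb
    have q1 : LeftOf n lev Q a s := by
      rw [← hQ.not_leftOf_iff has.1.symm hpos has.le.2 has.le.1]
      intro hc
      have := hmin (a, s) ⟨has, hc⟩
      simp only at this
      linarith
    have q2 : LeftOf n lev Q s b := by
      rw [← hQ.not_leftOf_iff hsb.1.symm hpos hsb.le.2 hsb.le.1]
      intro hc
      have := hmin (s, b) ⟨hsb, hc⟩
      simp only at this
      linarith
    exact hQ.leftOf_asymm (hQ.leftOf_trans q1 q2 hab.le.1 hab.le.2) hba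
  have l0 : lev a ≠ lev b := by
    intro e
    have hne' := hab.1
    rw [hP.leftOf_iff_lt hne' (k := lev a) (by omega) (by omega), h a b e,
      ← hQ.leftOf_iff_lt hne' (k := lev a) (by omega) (by omega)] at hab
    exact hQ.leftOf_asymm hab hba
  have l1 : lev b ≠ lev a + n := fun e =>
    not_leftOf_of_level_eq_add hconn hsimply hP hQ h e hab hba
  have l2 : lev a ≠ lev b + n := fun e =>
    not_leftOf_of_level_eq_add hconn hsimply hQ hP h.symm e hba hab
  have hle := hab.le
  obtain ⟨p, q, hpq, o1, o2⟩ : ∃ p q, (p = a ∧ q = b ∨ p = b ∧ q = a) ∧ lev p < lev q ∧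
      lev q < lev p + n := by
    rcases lt_or_gt_of_ne l0 with hlt | hlt
    · exact ⟨a, b, .inl ⟨rfl, rfl⟩, hlt, by omega⟩
    · exact ⟨b, a, .inr ⟨rfl, rfl⟩, hlt, by omega⟩
  have hP' := hP.flip_of_covBy hconn hsimply hQ h hab hba hcov hpq o1 o2
  refine ⟨p, q, o1, o2, fun e => ?_, hP', fun i j hij => ?_,
    reversedPairs_flip_ssubset hP hQ hab hba hcov hpq o1 o2 hP'⟩
  · have := hP.inj p q (lev q) o1.le o2 le_rfl (by omega) e
    subst this
    omega
  · exact (hP.sameOrder_flip o1 o2 hP' i j hij).trans (h i j hij)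

/-- Tilings in which all pairs of tiles lie in the same order coincide: on each diagonal the tiles
are met in the same order. -/
theorem eq_of_reversedPairs_eq_empty [Fintype ι] (hP : IsLabelledTiling n R lev P)
    (hQ : IsLabelledTiling n R lev Q) (h : reversedPairs n lev P Q = ∅) (i : ι) (k : ℤ)
    (hk : lev i ≤ k) (hk' : k < lev i + n) : P i k = Q i k := by
  have hlt : ∀ j, lev j ≤ k → k < lev j + n → (P j k < P i k ↔ Q j k < Q i k) := by
    intro j hj hj'
    rcases eq_or_ne j i with rfl | hne
    · simp
    rw [← hP.leftOf_iff_lt hne (k := k) ⟨hj, hj'⟩ ⟨hk, hk'⟩,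
      ← hQ.leftOf_iff_lt hne (k := k) ⟨hj, hj'⟩ ⟨hk, hk'⟩]
    have hn : 0 < n := by omega
    constructor <;> intro hl
    · by_contra hc
      rw [hQ.not_leftOf_iff hne hn (by omega) (by omega)] at hc
      exact (Set.eq_empty_iff_forall_notMem.1 h (j, i)) ⟨hl, hc⟩
    · by_contra hc
      rw [hP.not_leftOf_iff hne hn (by omega) (by omega)] at hc
      exact (Set.eq_empty_iff_forall_notMem.1 h (i, j)) ⟨hc, hl⟩
  have hc : squareCount R k (P i k) = squareCount R k (Q i k) := by
    rw [← hP.card_active, ← hQ.card_active]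
    congr 1
    ext j
    simp only [Finset.mem_filter, Finset.mem_univ, true_and]
    exact and_congr_right fun hj => hlt j hj.1 hj.2
  have mono : ∀ x y : ℤ, x < y → (x, k - x) ∈ R → squareCount R k x < squareCount R k y := by
    intro x y hxy hx
    refine Finset.card_lt_card (Finset.ssubset_iff_of_subset ?_ |>.2 ⟨(x, k - x), ?_, ?_⟩)
    · intro s
      simp only [Finset.mem_filter]
      rintro ⟨h1, h2, h3⟩
      exact ⟨h1, h2, by omega⟩
    · simp [hx, hxy]
    · simp
  rcases lt_trichotomy (P i k) (Q i k) with hl | hl | hl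
  · exact absurd hc (mono _ _ hl ((hP.mem _ _).2 ⟨i, hk, hk', rfl⟩)).ne
  · exact hl
  · exact absurd hc (mono _ _ hl ((hQ.mem _ _).2 ⟨i, hk, hk', rfl⟩)).ne'

/-! ### Ribbon tiles as paths -/

/-- The tile with one square on each diagonal `x + y = k` for `l ≤ k < l + n`, whose first
coordinate is `x k`. -/
noncomputable def tileOf (n : ℕ) (l : ℤ) (x : ℤ → ℤ) : Finset Square :=
  (Finset.Ico l (l + n)).image fun k => (x k, k - x k)

/-- The set of tiles of a labelled tiling. -/
noncomputable def tilesOf [Fintype ι] (n : ℕ) (lev : ι → ℤ) (P : ι → ℤ → ℤ) :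
    Finset (Finset Square) :=
  Finset.univ.image fun i => tileOf n (lev i) (P i)

theorem mem_tileOf {l : ℤ} {x : ℤ → ℤ} {s : Square} :
    s ∈ tileOf n l x ↔ l ≤ s.1 + s.2 ∧ s.1 + s.2 < l + n ∧ x (s.1 + s.2) = s.1 := by
  obtain ⟨u, v⟩ := s
  simp only [tileOf, Finset.mem_image, Finset.mem_Ico, Prod.mk.injEq]
  constructor
  · rintro ⟨k, ⟨h1, h2⟩, h3, h4⟩
    obtain rfl : k = u + v := by omega
    exact ⟨h1, h2, h3⟩
  · rintro ⟨h1, h2, h3⟩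
    exact ⟨u + v, ⟨h1, h2⟩, h3, by omega⟩

theorem mk_mem_tileOf {l : ℤ} {x : ℤ → ℤ} {u k : ℤ} :
    ((u, k - u) : Square) ∈ tileOf n l x ↔ l ≤ k ∧ k < l + n ∧ x k = u := by
  rw [mem_tileOf]
  simp

theorem tileOf_congr {l : ℤ} {x x' : ℤ → ℤ} (h : ∀ k, l ≤ k → k < l + n → x k = x' k) :
    tileOf n l x = tileOf n l x' := by
  ext s
  rw [mem_tileOf, mem_tileOf]
  exact and_congr_right fun h1 => and_congr_right fun h2 => by rw [h _ h1 h2]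

theorem mem_tilesOf [Fintype ι] {t : Finset Square} :
    t ∈ tilesOf n lev P ↔ ∃ i, tileOf n (lev i) (P i) = t := by
  simp [tilesOf]

theorem exists_adj_of_level {t : Finset Square} (ht : IsConnectedSet t) {a b : Square}
    (ha : a ∈ t) (hb : b ∈ t) {k : ℤ} (hak : a.1 + a.2 ≤ k) (hbk : k < b.1 + b.2) :
    ∃ p ∈ t, ∃ q ∈ t, grid.Adj p q ∧ p.1 + p.2 = k ∧ q.1 + q.2 = k + 1 := by
  obtain ⟨w, hw⟩ := exists_walk_of_isConnectedSet ht ha hb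
  induction w with
  | nil => omega
  | @cons a c b hac w ih =>
    have hc : c ∈ t := hw c (by simp)
    by_cases hck : c.1 + c.2 ≤ k
    · exact ih hc hb hck hbk fun v hv => hw v (by simp [hv])
    · refine ⟨a, ha, c, hc, hac, ?_⟩
      have : |a.1 - c.1| + |a.2 - c.2| = 1 := hac
      simp only [Int.abs_eq_natAbs] at this
      omega

/-- A ribbon tile is a path that goes up or right at each step: its squares have distinct colors,
so connectedness makes their levels `n` consecutive integers. -/
theorem IsRibbonTile.exists_eq_tileOf (hn : 0 < n) {t : Finset Square} (ht : IsRibbonTile n t) :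
    ∃ (l : ℤ) (x : ℤ → ℤ), (∀ k, l ≤ k → k + 1 < l + n → x (k + 1) = x k ∨ x (k + 1) = x k + 1) ∧
      tileOf n l x = t := by
  obtain ⟨hc, hcol⟩ := ht
  have hinj : ∀ s ∈ t, ∀ s' ∈ t, (n : ℤ) ∣ (s'.1 + s'.2) - (s.1 + s.2) → s = s' := by
    intro s hs s' hs' hd
    refine (hcol (color n s)).unique ⟨hs, rfl⟩ ⟨hs', ?_⟩
    exact ((ZMod.intCast_eq_intCast_iff_dvd_sub _ _ _).2 hd).symm
  have hne : t.Nonempty := by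
    obtain ⟨s, ⟨hs, -⟩, -⟩ := hcol 0
    exact ⟨s, hs⟩
  obtain ⟨a, ha, hmin⟩ := t.exists_min_image (fun s => s.1 + s.2) hne
  obtain ⟨b, hb, hmax⟩ := t.exists_max_image (fun s => s.1 + s.2) hne
  have hat : ∀ k, a.1 + a.2 ≤ k → k ≤ b.1 + b.2 → ∃ s ∈ t, s.1 + s.2 = k := by
    intro k h1 h2
    rcases h2.eq_or_lt with rfl | h2
    · exact ⟨b, hb, rfl⟩
    · obtain ⟨p, hp, -, -, -, hpk, -⟩ := exists_adj_of_level hc ha hb h1 h2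
      exact ⟨p, hp, hpk⟩
  have hup : b.1 + b.2 < a.1 + a.2 + n := by
    by_contra hlt
    obtain ⟨s, hs, hsk⟩ := hat (a.1 + a.2 + n) (by omega) (by omega)
    have := hinj a ha s hs ⟨1, by omega⟩
    subst this
    omega
  have hlow : a.1 + a.2 + n ≤ b.1 + b.2 + 1 := by
    obtain ⟨s, ⟨hs, hsc⟩, -⟩ := hcol ((b.1 + b.2 + 1 : ℤ) : ZMod n)
    rw [color, ZMod.intCast_eq_intCast_iff_dvd_sub] at hsc
    have h1 := hmax s hs
    have h2 := hmin s hs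
    have := Int.le_of_dvd (by omega) hsc
    omega
  choose! f hf hfk using fun k (h : a.1 + a.2 ≤ k ∧ k ≤ b.1 + b.2) => hat k h.1 h.2
  have hfe : ∀ s ∈ t, f (s.1 + s.2) = s := fun s hs => by
    have h : a.1 + a.2 ≤ s.1 + s.2 ∧ s.1 + s.2 ≤ b.1 + b.2 := ⟨hmin s hs, hmax s hs⟩
    exact hinj _ (hf _ h) s hs (by rw [hfk _ h]; simp)
  refine ⟨a.1 + a.2, fun k => (f k).1, fun k h1 h2 => ?_, ?_⟩
  · have k1 : a.1 + a.2 ≤ k ∧ k ≤ b.1 + b.2 := by omega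
    have k2 : a.1 + a.2 ≤ k + 1 ∧ k + 1 ≤ b.1 + b.2 := by omega
    obtain ⟨p, hp, q, hq, hpq, hpk, hqk⟩ := exists_adj_of_level hc (hf k k1) (hf (k + 1) k2)
      (k := k) (hfk k k1).le (by rw [hfk _ k2]; omega)
    have e1 := hfe p hp
    have e2 := hfe q hq
    rw [hpk] at e1
    rw [hqk] at e2
    simp only [e1, e2]
    have : |p.1 - q.1| + |p.2 - q.2| = 1 := hpq
    simp only [Int.abs_eq_natAbs] at this
    omega
  · ext s
    rw [mem_tileOf]
    constructor
    · rintro ⟨h1, h2, h3⟩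
      have h : a.1 + a.2 ≤ s.1 + s.2 ∧ s.1 + s.2 ≤ b.1 + b.2 := by omega
      have h4 := hfk _ h
      have : f (s.1 + s.2) = s := Prod.ext h3 (by omega)
      rw [← this]
      exact hf _ h
    · intro hs
      have h1 := hmin s hs
      have h2 := hmax s hs
      exact ⟨h1, by omega, by rw [hfe s hs]⟩

theorem isRibbonTile_tileOf (hn : 0 < n) {l : ℤ} {x : ℤ → ℤ}
    (hx : ∀ k, l ≤ k → k + 1 < l + n → x (k + 1) = x k ∨ x (k + 1) = x k + 1) :
    IsRibbonTile n (tileOf n l x) := by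
  have hn' : (0 : ℤ) < n := by exact_mod_cast hn
  refine ⟨?_, fun c => ?_⟩
  · have hm : ∀ k, l ≤ k → k < l + n →
        (x k, k - x k) ∈ ((tileOf n l x : Finset Square) : Set Square) :=
      fun k h1 h2 => Finset.mem_coe.2 (mk_mem_tileOf.2 ⟨h1, h2, rfl⟩)
    have hreach : ∀ k (h1 : l ≤ k) (h2 : k < l + n),
        (grid.induce ((tileOf n l x : Finset Square) : Set Square)).Reachable
          ⟨_, hm l le_rfl (by omega)⟩ ⟨_, hm k h1 h2⟩ := by
      intro k h1
      induction k, h1 using Int.leInduction with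
      | base => exact fun _ => .rfl
      | succ k h1 ih =>
        intro h2
        refine (ih (by omega)).trans (SimpleGraph.Adj.reachable ?_)
        have : |x k - x (k + 1)| + |(k - x k) - (k + 1 - x (k + 1))| = 1 := by
          have := hx k h1 h2
          simp only [Int.abs_eq_natAbs]
          omega
        exact this
    have hall : ∀ s : ((tileOf n l x : Finset Square) : Set Square),
        (grid.induce ((tileOf n l x : Finset Square) : Set Square)).Reachable
          ⟨_, hm l le_rfl (by omega)⟩ s := by
      rintro ⟨⟨u, v⟩, hs⟩
      obtain ⟨h1, h2, h3⟩ := mem_tileOf.1 (Finset.mem_coe.1 hs)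
      simp only at h1 h2 h3
      have := hreach (u + v) h1 h2
      convert this using 3
      · exact h3.symm
      · omega
    exact fun s s' => (hall s).symm.trans (hall s')
  · obtain ⟨m, rfl⟩ := ZMod.intCast_surjective c
    obtain ⟨k, hk⟩ : ∃ k, k = l + (m - l) % n := ⟨_, rfl⟩
    have h1 := Int.emod_nonneg (m - l) hn'.ne'
    have h2 := Int.emod_lt_of_pos (m - l) hn'
    refine ⟨(x k, k - x k), ⟨mk_mem_tileOf.2 ⟨by omega, by omega, rfl⟩, ?_⟩, ?_⟩
    · simp only [color]
      rw [ZMod.intCast_eq_intCast_iff_dvd_sub]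
      have := Int.emod_add_mul_ediv (m - l) n
      exact ⟨(m - l) / n, by omega⟩
    · rintro ⟨u, v⟩ ⟨hs, hc⟩
      obtain ⟨h3, h4, h5⟩ := mem_tileOf.1 hs
      simp only [color] at h3 h4 h5 hc
      rw [ZMod.intCast_eq_intCast_iff_dvd_sub] at hc
      have h6 : (m - l) % n = (u + v - l) % n := by
        rw [Int.emod_eq_emod_iff_emod_sub_eq_zero]
        exact Int.emod_eq_zero_of_dvd (by convert hc using 1; ring)
      rw [Int.emod_eq_of_lt (a := u + v - l) (by omega) (by omega)] at h6
      obtain rfl : k = u + v := by omega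
      rw [h5]
      simp

theorem IsRibbonTiling.exists_isLabelledTiling (hn : 0 < n) {α : Finset (Finset Square)}
    (h : IsRibbonTiling n R α) :
    ∃ (lev : α → ℤ) (P : α → ℤ → ℤ), IsLabelledTiling n R lev P ∧ tilesOf n lev P = α := by
  obtain ⟨h1, h2, h3⟩ := h
  choose lev P hstep htile using fun t : α => (h1 t t.2).exists_eq_tileOf hn
  refine ⟨lev, P, ⟨hstep, ?_, ?_⟩, ?_⟩
  · intro i j k hi hi' hj hj' hij
    by_contra hne
    have hd := h2 i i.2 j j.2 fun e => hne (Subtype.ext e)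
    rw [← htile i, ← htile j] at hd
    exact Finset.disjoint_left.1 hd (mk_mem_tileOf.2 ⟨hi, hi', rfl⟩)
      (mk_mem_tileOf.2 ⟨hj, hj', hij.symm⟩)
  · intro x k
    rw [h3]
    constructor
    · rintro ⟨t, ht, hs⟩
      refine ⟨⟨t, ht⟩, ?_⟩
      have e := htile ⟨t, ht⟩
      simp only at e
      rw [← e] at hs
      exact mk_mem_tileOf.1 hs
    · rintro ⟨i, hi⟩
      refine ⟨i, i.2, ?_⟩
      rw [← htile i]
      exact mk_mem_tileOf.2 hi
  · ext t
    rw [mem_tilesOf]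
    constructor
    · rintro ⟨i, rfl⟩
      rw [htile]
      exact i.2
    · exact fun ht => ⟨⟨t, ht⟩, htile _⟩

theorem IsLabelledTiling.disjoint_tileOf (h : IsLabelledTiling n R lev P) {i j : ι} (hij : i ≠ j) :
    Disjoint (tileOf n (lev i) (P i)) (tileOf n (lev j) (P j)) := by
  rw [Finset.disjoint_left]
  intro s hi hj
  obtain ⟨a1, a2, a3⟩ := mem_tileOf.1 hi
  obtain ⟨b1, b2, b3⟩ := mem_tileOf.1 hj
  exact hij (h.inj i j _ a1 a2 b1 b2 (a3.trans b3.symm))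

theorem IsLabelledTiling.tileOf_injective (hn : 0 < n) (h : IsLabelledTiling n R lev P) :
    Function.Injective fun i => tileOf n (lev i) (P i) := by
  intro i j hij
  by_contra hne
  have hd := h.disjoint_tileOf hne
  simp only at hij
  rw [hij, Finset.disjoint_self_iff_empty] at hd
  have : (P j (lev j), lev j - P j (lev j)) ∈ tileOf n (lev j) (P j) :=
    mk_mem_tileOf.2 ⟨le_rfl, by omega, rfl⟩
  rw [hd] at this
  simp at this

theorem IsLabelledTiling.isRibbonTiling [Fintype ι] (hn : 0 < n) (h : IsLabelledTiling n R lev P) :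
    IsRibbonTiling n R (tilesOf n lev P) := by
  refine ⟨?_, ?_, ?_⟩
  · intro t ht
    obtain ⟨i, rfl⟩ := mem_tilesOf.1 ht
    exact isRibbonTile_tileOf hn (h.step i)
  · intro t ht u hu htu
    obtain ⟨i, rfl⟩ := mem_tilesOf.1 ht
    obtain ⟨j, rfl⟩ := mem_tilesOf.1 hu
    exact h.disjoint_tileOf (by rintro rfl; exact htu rfl)
  · rintro ⟨x, y⟩
    have := h.mem x (x + y)
    rw [add_sub_cancel_left] at this
    rw [this]
    constructor
    · rintro ⟨i, hi⟩
      exact ⟨_, mem_tilesOf.2 ⟨i, rfl⟩, mem_tileOf.2 hi⟩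
    · rintro ⟨t, ht, hs⟩
      obtain ⟨i, rfl⟩ := mem_tilesOf.1 ht
      exact ⟨i, mem_tileOf.1 hs⟩

/-! ### Common labels of two tilings -/

theorem card_active_eq_add_sum [Fintype ι] (hn : 0 < n) (l : ℤ) :
    (Finset.univ.filter fun i => lev i ≤ l ∧ l < lev i + n).card =
      (Finset.univ.filter fun i => lev i = l).card +
        ∑ l' ∈ Finset.Ioo (l - n) l, (Finset.univ.filter fun i => lev i = l').card := by
  classical
  have hs : (Finset.univ.filter fun i => l - n < lev i ∧ lev i < l).card =
      ∑ l' ∈ Finset.Ioo (l - n) l, (Finset.univ.filter fun i => lev i = l').card := by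
    rw [Finset.card_eq_sum_card_fiberwise (f := lev) (t := Finset.Ioo (l - n) l)]
    · refine Finset.sum_congr rfl fun l' hl' => ?_
      rw [Finset.filter_filter]
      congr 1
      ext i
      simp only [Finset.mem_filter, Finset.mem_univ, true_and]
      rw [Finset.mem_Ioo] at hl'
      omega
    · intro i hi
      simpa using hi
  rw [← hs, ← Finset.card_union_of_disjoint]
  · congr 1
    ext i
    simp only [Finset.mem_filter, Finset.mem_union, Finset.mem_univ, true_and]
    omega
  · refine Finset.disjoint_filter.2 fun i _ => ?_
    omega

/-- The number of tiles of each level is determined by the region: the tiles of level `l` are those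
that meet the diagonal `l` and do not have one of the `n - 1` preceding levels. -/
theorem card_level_eq [Fintype ι] [Fintype κ] {lev' : κ → ℤ} {P' : κ → ℤ → ℤ} (hn : 0 < n)
    (h : IsLabelledTiling n R lev P) (h' : IsLabelledTiling n R lev' P') (l : ℤ) :
    (Finset.univ.filter fun i => lev i = l).card =
      (Finset.univ.filter fun j => lev' j = l).card := by
  obtain ⟨B, hB⟩ := exists_abs_bound R
  suffices H : ∀ m : ℕ, ∀ l < -2 * (B : ℤ) + m, (Finset.univ.filter fun i => lev i = l).card =
      (Finset.univ.filter fun j => lev' j = l).card from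
    H (l + 2 * B + 1).toNat l (by omega)
  have hact : ∀ k, (Finset.univ.filter fun i => lev i ≤ k ∧ k < lev i + n).card =
      (Finset.univ.filter fun j => lev' j ≤ k ∧ k < lev' j + n).card := by
    intro k
    have h1 := h.card_active k (B + 1)
    rw [← h'.card_active] at h1
    convert h1 using 2
    · ext i
      simp only [Finset.mem_filter, Finset.mem_univ, true_and]
      refine ⟨fun hi => ⟨hi, ?_⟩, fun hi => hi.1⟩
      have := (hB _ _ ((h.mem _ _).2 ⟨i, hi.1, hi.2, rfl⟩)).1
      rw [abs_le] at this
      omega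
    · ext i
      simp only [Finset.mem_filter, Finset.mem_univ, true_and]
      refine ⟨fun hi => ⟨hi, ?_⟩, fun hi => hi.1⟩
      have := (hB _ _ ((h'.mem _ _).2 ⟨i, hi.1, hi.2, rfl⟩)).1
      rw [abs_le] at this
      omega
  intro m
  induction m with
  | zero =>
    intro l hl
    rw [Finset.card_eq_zero.2, Finset.card_eq_zero.2]
    · refine Finset.filter_eq_empty_iff.2 fun j _ hj => ?_
      have := hB _ _ ((h'.mem _ l).2 ⟨j, hj.le, by omega, rfl⟩)
      simp only [abs_le] at this
      push_cast at hl
      omega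
    · refine Finset.filter_eq_empty_iff.2 fun j _ hj => ?_
      have := hB _ _ ((h.mem _ l).2 ⟨j, hj.le, by omega, rfl⟩)
      simp only [abs_le] at this
      push_cast at hl
      omega
  | succ m ih =>
    intro l hl
    by_cases hlm : l < -2 * (B : ℤ) + m
    · exact ih l hlm
    have h1 := hact l
    rw [card_active_eq_add_sum hn, card_active_eq_add_sum hn] at h1
    rw [Finset.sum_congr rfl fun l' hl' => ih l' (by
      rw [Finset.mem_Ioo] at hl'; push_cast at hl; omega)] at h1
    exact Nat.add_right_cancel h1

theorem exists_equiv_lt_iff {A B : Type*} [Fintype A] [Fintype B]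
    (hc : Fintype.card A = Fintype.card B) {f : A → ℤ} {g : B → ℤ} (hf : Function.Injective f)
    (hg : Function.Injective g) : ∃ e : A ≃ B, ∀ a a', f a < f a' ↔ g (e a) < g (e a') := by
  let _ : LinearOrder A := LinearOrder.lift' f hf
  let _ : LinearOrder B := LinearOrder.lift' g hg
  let e : A ≃o B :=
    (Fintype.orderIsoFinOfCardEq A hc).symm.trans (Fintype.orderIsoFinOfCardEq B rfl)
  exact ⟨e.toEquiv, fun a a' => e.lt_iff_lt.symm⟩

/-- Two labelled tilings of a region can be given the same labels, which record the level of a tile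
and its place in the left-to-right order of the tiles of that level. -/
theorem exists_relabelling [Fintype ι] [Fintype κ] {lev' : κ → ℤ} {P' : κ → ℤ → ℤ} (hn : 0 < n)
    (h : IsLabelledTiling n R lev P) (h' : IsLabelledTiling n R lev' P') :
    ∃ e : ι ≃ κ, (∀ i, lev' (e i) = lev i) ∧ SameOrder lev (fun i => P' (e i)) P := by
  classical
  have hfib : ∀ l, ∃ e : {i // lev i = l} ≃ {j // lev' j = l},
      ∀ a a', P a.1 l < P a'.1 l ↔ P' (e a).1 l < P' (e a').1 l := by
    intro l
    refine exists_equiv_lt_iff ?_ (f := fun a : {i // lev i = l} => P a.1 l)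
      (g := fun b : {j // lev' j = l} => P' b.1 l) ?_ ?_
    · rw [Fintype.card_subtype, Fintype.card_subtype]
      exact card_level_eq hn h h' l
    · rintro ⟨a, ha⟩ ⟨b, hb⟩ hab
      exact Subtype.ext (h.inj a b l ha.le (by omega) hb.le (by omega) hab)
    · rintro ⟨a, ha⟩ ⟨b, hb⟩ hab
      exact Subtype.ext (h'.inj a b l ha.le (by omega) hb.le (by omega) hab)
  choose e he using hfib
  refine ⟨((Equiv.sigmaFiberEquiv lev).symm.trans (Equiv.sigmaCongrRight e)).trans
    (Equiv.sigmaFiberEquiv lev'), fun i => (e (lev i) ⟨i, rfl⟩).2, ?_⟩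
  intro i j hij
  have h1 := he (lev i) ⟨i, rfl⟩ ⟨j, hij.symm⟩
  have h2 : ∀ l (hl : lev j = l), (e l ⟨j, hl⟩).1 = (e (lev j) ⟨j, rfl⟩).1 := by
    rintro l rfl
    rfl
  rw [h2] at h1
  exact h1.symm

/-! ### Local moves -/

theorem localMove_flip [Fintype ι] (hn : 0 < n) (hP : IsLabelledTiling n R lev P) {p q : ι}
    (h1 : lev p < lev q) (h2 : lev q < lev p + n) (hne : P p (lev q) ≠ P q (lev q))
    (h' : IsLabelledTiling n R lev (flip n lev P p q)) :
    LocalMove n R (tilesOf n lev P) (tilesOf n lev (flip n lev P p q)) := by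
  classical
  have hpq : p ≠ q := by rintro rfl; omega
  refine ⟨hP.isRibbonTiling hn, h'.isRibbonTiling hn, tileOf n (lev p) (P p),
    tileOf n (lev q) (P q),
    tileOf n (lev p) (flip n lev P p q p), tileOf n (lev q) (flip n lev P p q q),
    mem_tilesOf.2 ⟨p, rfl⟩, mem_tilesOf.2 ⟨q, rfl⟩, (hP.tileOf_injective hn).ne hpq,
    (h'.tileOf_injective hn).ne hpq, fun heq => ?_, ?_⟩
  · have hm : tileOf n (lev p) (flip n lev P p q p) ∈
        ({tileOf n (lev p) (P p), tileOf n (lev q) (P q)} : Finset (Finset Square)) := by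
      rw [← heq]
      simp
    rw [Finset.mem_insert, Finset.mem_singleton] at hm
    rcases hm with hm | hm
    · have : (P q (lev q), lev q - P q (lev q)) ∈ tileOf n (lev p) (flip n lev P p q p) :=
        mk_mem_tileOf.2 ⟨h1.le, h2, by rw [flip_left, if_neg (by omega)]⟩
      rw [hm] at this
      exact hne (mk_mem_tileOf.1 this).2.2
    · have : (P p (lev p), lev p - P p (lev p)) ∈ tileOf n (lev p) (flip n lev P p q p) :=
        mk_mem_tileOf.2 ⟨le_rfl, by omega, by rw [flip_left, if_pos (by omega)]⟩
      rw [hm] at this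
      have := (mk_mem_tileOf.1 this).1
      omega
  · ext t
    simp only [Finset.mem_union, Finset.mem_sdiff, Finset.mem_insert, Finset.mem_singleton,
      mem_tilesOf]
    have hother : ∀ i, i ≠ p → i ≠ q →
        tileOf n (lev i) (flip n lev P p q i) = tileOf n (lev i) (P i) := fun i hp hq =>
      tileOf_congr fun k _ _ => flip_of_ne hp hq k
    constructor
    · rintro ⟨i, rfl⟩
      by_cases hp : i = p
      · subst hp
        exact .inr (.inl rfl)
      by_cases hq : i = q
      · subst hq
        exact .inr (.inr rfl)
      rw [hother i hp hq]
      refine .inl ⟨⟨i, rfl⟩, ?_⟩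
      rintro (e | e)
      · exact hp (hP.tileOf_injective hn e)
      · exact hq (hP.tileOf_injective hn e)
    · rintro (⟨⟨i, rfl⟩, hi⟩ | rfl | rfl)
      · push Not at hi
        have hp : i ≠ p := by rintro rfl; exact hi.1 rfl
        have hq : i ≠ q := by rintro rfl; exact hi.2 rfl
        exact ⟨i, hother i hp hq⟩
      · exact ⟨p, rfl⟩
      · exact ⟨q, rfl⟩

/-- Induction on the number of pairs of tiles in opposite order. -/
theorem reflTransGen_localMove [Fintype ι] (hn : 0 < n) (hconn : IsConnectedSet R)
    (hsimply : IsSimplyConnectedSet R) (hQ : IsLabelledTiling n R lev Q) (m : ℕ) :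
    ∀ P, IsLabelledTiling n R lev P → SameOrder lev P Q → (reversedPairs n lev P Q).ncard = m →
      Relation.ReflTransGen (LocalMove n R) (tilesOf n lev P) (tilesOf n lev Q) := by
  induction m using Nat.strong_induction_on with
  | _ m ih =>
    intro P hP h hm
    rcases (reversedPairs n lev P Q).eq_empty_or_nonempty with he | hne
    · have : tilesOf n lev P = tilesOf n lev Q := by
        unfold tilesOf
        congr 1
        funext i
        exact tileOf_congr fun k h1 h2 => eq_of_reversedPairs_eq_empty hP hQ he i k h1 h2
      rw [this]
    · obtain ⟨p, q, h1, h2, h3, hP', h', hlt⟩ := exists_flip hconn hsimply hP hQ h hne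
      have hcard := Set.ncard_lt_ncard hlt (Set.toFinite _)
      exact .head (localMove_flip hn hP h1 h2 h3 hP') (ih _ (hm ▸ hcard) _ hP' h' rfl)

end RibbonTiling

theorem mainTheorem2 (n : ℕ) (hn : 1 ≤ n) (R : Finset RibbonTiling.Square)
    (hconn : RibbonTiling.IsConnectedSet R) (hsimply : RibbonTiling.IsSimplyConnectedSet R)
    (α β : Finset (Finset RibbonTiling.Square))
    (hα : RibbonTiling.IsRibbonTiling n R α) (hβ : RibbonTiling.IsRibbonTiling n R β) :
    Relation.ReflTransGen (RibbonTiling.LocalMove n R) α β := by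
  obtain ⟨levα, P, hP, hPα⟩ := hα.exists_isLabelledTiling hn
  obtain ⟨levβ, Q, hQ, hQβ⟩ := hβ.exists_isLabelledTiling hn
  obtain ⟨e, he, hord⟩ := RibbonTiling.exists_relabelling hn hQ hP
  have hP' : RibbonTiling.IsLabelledTiling n R levβ fun i => P (e i) := by
    refine ⟨fun i => ?_, fun i j => ?_, fun x k => ?_⟩
    · rw [← he]
      exact hP.step (e i)
    · rw [← he i, ← he j]
      exact fun k a b c d hij => e.injective (hP.inj _ _ k a b c d hij)
    · rw [hP.mem, ← e.exists_congr_right]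
      simp only [he]
  have htiles : RibbonTiling.tilesOf n levβ (fun i => P (e i)) =
      RibbonTiling.tilesOf n levα P := by
    ext t
    rw [RibbonTiling.mem_tilesOf, RibbonTiling.mem_tilesOf, ← e.exists_congr_right]
    simp only [he]
  rw [← hPα, ← hQβ, ← htiles]
  exact RibbonTiling.reflTransGen_localMove hn hconn hsimply hQ _ _ hP' hord rfl
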